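/- All matrices are real and square, of size $n\times n$. A matrix $C$ is irreducible if its directed graph (with an arc $i\to j$ whenever $c_{ij}\ne 0$) is strongly connected, and reducible otherwise; it is completely reducible if, after a simultaneous permutation of rows and columns, it is a direct sum of two nonempty square matrices. A matrix is totally nonnegative if all its minors are nonnegative, and flat if all its entries are equal. $C$ is a generalized ultrametric matrix if its entries are nonnegative, $c_{ii}\ge\max\{c_{ij},c_{ji}\}$ for all $i,j$, and every set of three distinct indices has a labeling $\{i,j,k\}$ with $c_{ij}=c_{ik}$, $c_{ji}=c_{ki}$, $\min\{c_{jk},c_{kj}\}\ge\min\{c_{ji},c_{ij}\}$ and $\max\{c_{jk},c_{kj}\}\ge\max\{c_{ji},c_{ij}\}$. Let $0\le p\le n$. $C$ is a cyclops with eye $p+$ and parameters $a_1,\dots,a_n,b_1,b_2$ if $c_{ij}=a_{\max\{i,j\}}$ for $i,j\le p$, $c_{ij}=a_{\min\{i,j\}}$ for $i,j>p$, $c_{ij}=b_1$ for $i\le p<j$, $c_{ij}=b_2$ for $j\le p<i$, where $a_1>a_2>\dots>a_p$ and $a_n>a_{n-1}>\dots>a_{p+1}$. $C$ is a G-cyclops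 if it is nonsingular and, for some $1\le p\le n$, it is a cyclops with eye $p+$ and parameters satisfying $\min\{a_p,a_{p+1}\}\ge\max\{b_1,b_2\}$ and $\min\{b_1,b_2\}>0$ (for $p=n$, where there is no $a_{p+1}$, the condition on $a_{p+1}$ is dropped, so that the requirement is just $a_n>0$). **Theorem.** Let $C$ be a nonsingular matrix that is reducible but not completely reducible. Then the following are equivalent. (i) Either $C$ or $C^T$ is of the block upper triangular form $$\begin{pmatrix} B_{11} & B_{12} & \cdots & B_{1m}\\ 0 & B_{22} & \cdots & B_{2m}\\ \vdots & \ddots & \ddots & \vdots\\ 0 & \cdots & 0 & B_{mm}\end{pmatrix},\qquad m\ge 2,$$ with nonempty square diagonal blocks, where $B_{11}$ is a G-cyclops whose last column has constant value $f_{11}$; $B_{mm}$ is a G-cyclops whose first row has constant value $f_{mm}$; each $B_{st}$, $1\le s<t\le m$, is a flat matrix with value $f_{st}$; each $B_{ss}$, $2\le s\le m-1$, is either a positive number $f_{ss}$ or an entrywise positive matrix $\begin{pmatrix} f_{ss}&f_{ss}\\ g_{ss}&f_{ss}\end{pmatrix}$ with $g_{ss}<f_{ss}$; and for some $1\le q\le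 m-1$, $$f_{11}\ge f_{22}\ge\dots\ge f_{qq}>0,\qquad 0<f_{q+1,q+1}\le f_{q+2,q+2}\le\dots\le f_{mm},$$ $$f_{1t}=f_{2t}=\dots=f_{t-1,t}=f_{tt}\quad\text{for } 1<t\le q,$$ $$f_{ss}=f_{s,s+1}=\dots=f_{sm}\quad\text{for } q<s<m,$$ $$0<f_{st}=f_{q,q+1}\le\min\{f_{qq},f_{q+1,q+1}\}\quad\text{for } 1\le s\le q<t\le m.$$ (ii) $C$ is a generalized ultrametric matrix whose inverse is tridiagonal. (iii) $C$ is a totally nonnegative generalized ultrametric matrix. -/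

import Mathlib

namespace Cyclops

/-- `C` is irreducible: its directed graph, with an arc from `i` to `j` whenever `C i j ≠ 0`, is
strongly connected. (No sign condition on the entries is imposed.) -/
def Irreducible {n : ℕ} (C : Matrix (Fin n) (Fin n) ℝ) : Prop :=
  ∀ i j : Fin n, Relation.ReflTransGen (fun k l : Fin n => C k l ≠ 0) i j

/-- `C` is completely reducible: after a simultaneous permutation of its rows and columns it is
the direct sum of two nonempty square matrices. -/
def CompletelyReducible {n : ℕ} (C : Matrix (Fin n) (Fin n) ℝ) : Prop :=
  ∃ S : Set (Fin n), S.Nonempty ∧ Sᶜ.Nonempty ∧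
    ∀ i ∈ S, ∀ j ∈ Sᶜ, C i j = 0 ∧ C j i = 0

/-- `A` is tridiagonal: the entries with `|i - j| > 1` vanish. -/
def Tridiagonal {n : ℕ} (A : Matrix (Fin n) (Fin n) ℝ) : Prop :=
  ∀ i j : Fin n, ((i : ℕ) + 1 < j ∨ (j : ℕ) + 1 < i) → A i j = 0

/-- `C` is totally nonnegative: all its minors, of every order, are nonnegative. -/
def TotallyNonneg {n : ℕ} (C : Matrix (Fin n) (Fin n) ℝ) : Prop :=
  ∀ (k : ℕ) (r c : Fin k → Fin n), StrictMono r → StrictMono c → 0 ≤ (C.submatrix r c).det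

/-- `C` is a generalized ultrametric matrix. -/
structure GeneralizedUltrametric {n : ℕ} (C : Matrix (Fin n) (Fin n) ℝ) : Prop where
  nonneg : ∀ i j, 0 ≤ C i j
  diag : ∀ i j, max (C i j) (C j i) ≤ C i i
  triangle : ∀ S : Finset (Fin n), S.card = 3 → ∃ i j k : Fin n, S = {i, j, k} ∧
    C i j = C i k ∧ C j i = C k i ∧
    min (C j i) (C i j) ≤ min (C j k) (C k j) ∧
    max (C j i) (C i j) ≤ max (C j k) (C k j)

/-- `C` is a cyclops with eye `m+` and parameters `a`, `b₁`, `b₂`. The leading `m × m` block is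
of flipped type D (its `(i, j)` entry is the parameter of index `max i j`, and the parameters
strictly decrease), the trailing `(n - m) × (n - m)` block is of type D (its `(i, j)` entry is the
parameter of index `min i j`, and the parameters strictly increase), the upper right block has all
entries `b₁` and the lower left block has all entries `b₂`. Indices start at `0`, so that
`i < m` says that `i` is one of the first `m` indices. -/
structure IsCyclops {n : ℕ} (C : Matrix (Fin n) (Fin n) ℝ) (m : ℕ) (a : Fin n → ℝ)
    (b₁ b₂ : ℝ) : Prop where
  eye_le : m ≤ n
  upper_left : ∀ i j : Fin n, (i : ℕ) < m → (j : ℕ) < m → C i j = a (max i j)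
  lower_right : ∀ i j : Fin n, m ≤ (i : ℕ) → m ≤ (j : ℕ) → C i j = a (min i j)
  upper_right : ∀ i j : Fin n, (i : ℕ) < m → m ≤ (j : ℕ) → C i j = b₁
  lower_left : ∀ i j : Fin n, m ≤ (i : ℕ) → (j : ℕ) < m → C i j = b₂
  decreasing : ∀ i j : Fin n, i < j → (j : ℕ) < m → a j < a i
  increasing : ∀ i j : Fin n, m ≤ (i : ℕ) → i < j → a i < a j

/-- `C` is a G-cyclops: it is nonsingular and, for some `1 ≤ m ≤ n`, it is a cyclops with eye `m+`
and parameters satisfying `min {aₘ, aₘ₊₁} ≥ max {b₁, b₂}` and `min {b₁, b₂} > 0`. With indices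
starting at `0`, the parameters `aₘ` and `aₘ₊₁` are the values of `a` at `m - 1` and at `m`; for
`m = n` there is no `aₘ₊₁`, and the condition on it is void. -/
def IsGCyclops {n : ℕ} (C : Matrix (Fin n) (Fin n) ℝ) : Prop :=
  C.det ≠ 0 ∧ ∃ (m : ℕ) (a : Fin n → ℝ) (b₁ b₂ : ℝ), 1 ≤ m ∧ IsCyclops C m a b₁ b₂ ∧
    (∀ i : Fin n, (i : ℕ) + 1 = m ∨ (i : ℕ) = m → max b₁ b₂ ≤ a i) ∧ 0 < min b₁ b₂

/-- The principal submatrix of `C` on the rows and columns in `R`, taken in increasing order. -/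
def principalSubmatrix {n : ℕ} (C : Matrix (Fin n) (Fin n) ℝ) (R : Finset (Fin n)) :
    Matrix (Fin R.card) (Fin R.card) ℝ :=
  C.submatrix (R.orderEmbOfFin rfl) (R.orderEmbOfFin rfl)

/-- The index set of the `s`-th block of a block partition `β`. -/
def blockSet {n : ℕ} (β : Fin n → ℕ) (s : ℕ) : Finset (Fin n) :=
  Finset.univ.filter (fun i => β i = s)

/-- The block upper triangular form. The partition of the indices into `m` consecutive nonempty
blocks, numbered `1, …, m`, is given by the monotone map `β` with range `{1, …, m}` that sends
an index to the number of its block. -/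
structure HasBlockForm {n : ℕ} (C : Matrix (Fin n) (Fin n) ℝ) (m q : ℕ) (β : Fin n → ℕ)
    (f : ℕ → ℕ → ℝ) : Prop where
  two_le : 2 ≤ m
  mono : Monotone β
  range_eq : Set.range β = Set.Icc 1 m
  /-- the blocks below the diagonal vanish -/
  below : ∀ i j, β j < β i → C i j = 0
  /-- the first diagonal block is a G-cyclops whose last column has constant value `f₁₁` -/
  first_gcyclops : IsGCyclops (principalSubmatrix C (blockSet β 1))
  first_column : ∀ i j : Fin (blockSet β 1).card, (j : ℕ) + 1 = (blockSet β 1).card →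
    principalSubmatrix C (blockSet β 1) i j = f 1 1
  /-- the last diagonal block is a G-cyclops whose first row has constant value `fₘₘ` -/
  last_gcyclops : IsGCyclops (principalSubmatrix C (blockSet β m))
  last_row : ∀ i j : Fin (blockSet β m).card, (i : ℕ) = 0 →
    principalSubmatrix C (blockSet β m) i j = f m m
  /-- the blocks above the diagonal are flat -/
  flat : ∀ i j, β i < β j → C i j = f (β i) (β j)
  /-- the other diagonal blocks are positive numbers or positive matrices of the form
  `!![fₛₛ, fₛₛ; gₛₛ, fₛₛ]` with `gₛₛ < fₛₛ` -/
  middle : ∀ s, 2 ≤ s → s ≤ m - 1 →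
    (∃ i : Fin n, blockSet β s = {i} ∧ C i i = f s s ∧ 0 < f s s) ∨
    (∃ (i j : Fin n) (g : ℝ), i < j ∧ blockSet β s = {i, j} ∧
      C.submatrix ![i, j] ![i, j] = !![f s s, f s s; g, f s s] ∧ 0 < g ∧ g < f s s)
  one_le_q : 1 ≤ q
  q_le : q ≤ m - 1
  diag_antitone : ∀ s, 1 ≤ s → s < q → f (s + 1) (s + 1) ≤ f s s
  diag_q_pos : 0 < f q q
  diag_succ_q_pos : 0 < f (q + 1) (q + 1)
  diag_monotone : ∀ s, q + 1 ≤ s → s < m → f s s ≤ f (s + 1) (s + 1)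
  column_eq : ∀ s t, 1 < t → t ≤ q → 1 ≤ s → s ≤ t → f s t = f t t
  row_eq : ∀ s t, q < s → s < m → s ≤ t → t ≤ m → f s t = f s s
  corner_pos : ∀ s t, 1 ≤ s → s ≤ q → q < t → t ≤ m → 0 < f s t
  corner_eq : ∀ s t, 1 ≤ s → s ≤ q → q < t → t ≤ m → f s t = f q (q + 1)
  corner_le : f q (q + 1) ≤ min (f q q) (f (q + 1) (q + 1))

end Cyclops

namespace Cyclops

/-! Both (ii) and (iii) reduce to one condition, the relations `Markov`: c_ik c_jj = c_ij c_jk for i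
< j < k, together with their transposes. A generalized ultrametric matrix satisfies c_ij c_jk ≤ c_ik
c_jj (`mul_le_mul_diag`), while the 2×2 minor on rows i, j and columns j, k asks for the opposite
inequality; so total nonnegativity forces the relations. Conversely, they allow the first row or
column of any minor to be cleared except for one nonnegative entry, and induction gives all minors.
For a nonsingular matrix with nonzero diagonal the same relations are equivalent to a tridiagonal
inverse.

It remains to match these conditions with the block form. Below the diagonal the relations say that
c_ki = 0 exactly when c_kj = 0 or c_ji = 0. Zeros on both sides of the diagonal then split the
matrix as a direct sum (`exists_cut`), so after a transposition everything above the diagonal is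
positive, and reducibility supplies a zero below it. A triple i < j < k now has only two shapes
(`triple`), so each index is flat in its column above the diagonal or in its row to the right of it.
By `exists_isCut` there is a cut, with zeros below it, before which columns are flat and after which
rows are. A flat 2×2 principal submatrix would make two rows of the matrix equal (`not_flat`); this
yields the strict inequalities that make the end blocks G-cyclopes and keep the middle blocks at
size at most two.

For the converse, the block form is turned into the entrywise description `PointForm`, from which
the ultrametric and Markov conditions are read off triple by triple. Transposition along the
secondary diagonal (`flip`) exchanges the two sides of the cut, so most arguments are needed only on
the left. -/

/-- The three conditions on a labelled triple in the definition of a generalized ultrametric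
matrix, with `p` the distinguished index. -/
def Isosceles {ι : Type*} (c : ι → ι → ℝ) (p q r : ι) : Prop :=
  c p q = c p r ∧ c q p = c r p ∧ min (c q p) (c p q) ≤ min (c q r) (c r q) ∧
    max (c q p) (c p q) ≤ max (c q r) (c r q)

theorem Isosceles.symm {ι : Type*} {c : ι → ι → ℝ} {p q r : ι} (h : Isosceles c p q r) :
    Isosceles c p r q := by
  obtain ⟨h1, h2, h3, h4⟩ := h
  refine ⟨h1.symm, h2.symm, ?_, ?_⟩
  · rw [← h1, ← h2, min_comm (c r q)]; exact h3
  · rw [← h1, ← h2, max_comm (c r q)]; exact h4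

theorem Isosceles.transpose {ι : Type*} {c : ι → ι → ℝ} {p q r : ι} (h : Isosceles c p q r) :
    Isosceles (fun i j => c j i) p q r := by
  obtain ⟨h1, h2, h3, h4⟩ := h
  refine ⟨h2, h1, ?_, ?_⟩
  · simpa only [min_comm] using h3
  · simpa only [max_comm] using h4

/-- The multiplicative relations between the entries that characterize, among nonsingular
matrices with nonzero diagonal entries, those with a tridiagonal inverse. -/
def Markov {ι : Type*} [LT ι] (c : ι → ι → ℝ) : Prop :=
  ∀ i j k, i < j → j < k → c i k * c j j = c i j * c j k ∧ c k i * c j j = c k j * c j i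

/-! ### Inequalities between entries of a generalized ultrametric matrix -/

variable {n : ℕ} {C : Matrix (Fin n) (Fin n) ℝ}

theorem GeneralizedUltrametric.isosceles (h : GeneralizedUltrametric C) {i j k : Fin n}
    (hij : i ≠ j) (hik : i ≠ k) (hjk : j ≠ k) :
    Isosceles C i j k ∨ Isosceles C j i k ∨ Isosceles C k i j := by
  obtain ⟨p, q, r, hS, hI⟩ := h.triangle {i, j, k} (Finset.card_eq_three.2 ⟨i, j, k, hij, hik, hjk, rfl⟩)
  replace hI : Isosceles C p q r := hI
  have hi : i ∈ ({p, q, r} : Finset (Fin n)) := by simp [← hS]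
  have hj : j ∈ ({p, q, r} : Finset (Fin n)) := by simp [← hS]
  have hk : k ∈ ({p, q, r} : Finset (Fin n)) := by simp [← hS]
  simp only [Finset.mem_insert, Finset.mem_singleton] at hi hj hk
  rcases hi with rfl | rfl | rfl <;> rcases hj with rfl | rfl | rfl <;>
    rcases hk with rfl | rfl | rfl <;> first
    | exact absurd rfl hij
    | exact absurd rfl hik
    | exact absurd rfl hjk
    | exact Or.inl hI
    | exact Or.inl hI.symm
    | exact Or.inr (Or.inl hI)
    | exact Or.inr (Or.inl hI.symm)
    | exact Or.inr (Or.inr hI)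
    | exact Or.inr (Or.inr hI.symm)

theorem GeneralizedUltrametric.le_row (h : GeneralizedUltrametric C) (i j : Fin n) :
    C i j ≤ C i i := (le_max_left _ _).trans (h.diag i j)

theorem GeneralizedUltrametric.le_col (h : GeneralizedUltrametric C) (i j : Fin n) :
    C i j ≤ C j j := (le_max_right _ _).trans (h.diag j i)

theorem GeneralizedUltrametric.transpose (h : GeneralizedUltrametric C) :
    GeneralizedUltrametric C.transpose where
  nonneg i j := h.nonneg j i
  diag i j := max_le (h.le_col _ _) (h.le_row _ _)
  triangle S hS := by
    obtain ⟨p, q, r, hS, hI⟩ := h.triangle S hS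
    exact ⟨p, q, r, hS, Isosceles.transpose hI⟩

theorem Markov.transpose (h : Markov C) : Markov C.transpose := by
  intro i j k hij hjk
  obtain ⟨h1, h2⟩ := h i j k hij hjk
  simp only [Matrix.transpose_apply]
  exact ⟨by rw [h2, mul_comm], by rw [h1, mul_comm]⟩

/-- The multiplicative triangle inequality for the entries of a generalized ultrametric matrix. -/
theorem GeneralizedUltrametric.mul_le_mul_diag (h : GeneralizedUltrametric C) (i j k : Fin n) :
    C i j * C j k ≤ C i k * C j j := by
  have h0 := h.nonneg
  have hr := h.le_row
  have hc := h.le_col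
  by_cases hij : i = j
  · subst hij; rw [mul_comm]
  by_cases hjk : j = k
  · subst hjk; rfl
  by_cases hik : i = k
  · subst hik; exact mul_le_mul (hr i j) (hr j i) (h0 _ _) (h0 _ _)
  rcases h.isosceles hij hik hjk with ⟨h1, -, -, -⟩ | ⟨h1, h2, h3, -⟩ | ⟨-, h2, -, -⟩
  · rw [h1]; exact mul_le_mul_of_nonneg_left (hr _ _) (h0 _ _)
  · rw [← h1]
    have h4 : min (C i j) (C j i) ≤ C i k := h3.trans (min_le_left _ _)
    have h5 : max (C i j) (C j i) ≤ C j j := max_le (hc i j) (hr j i)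
    -- With j distinguished, the product is `C i j * C j i`, that is, minimum times maximum, and the
    -- two factors are bounded separately.
    rw [← min_mul_max]
    exact mul_le_mul h4 h5 ((h0 _ _).trans (le_max_left _ _)) (h0 _ _)
  · rw [h2, mul_comm]; exact mul_le_mul_of_nonneg_left (hc _ _) (h0 _ _)

theorem GeneralizedUltrametric.diag_pos (h : GeneralizedUltrametric C) (hdet : C.det ≠ 0)
    (i : Fin n) : 0 < C i i := by
  refine lt_of_le_of_ne (h.nonneg i i) fun h0 => hdet ?_
  exact Matrix.det_eq_zero_of_row_eq_zero i fun j =>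
    le_antisymm ((h.le_row i j).trans h0.ge) (h.nonneg i j)

/-- Two indices of a nonsingular generalized ultrametric matrix never span a flat principal
submatrix. -/
theorem GeneralizedUltrametric.not_flat (h : GeneralizedUltrametric C) (hdet : C.det ≠ 0)
    {i j : Fin n} (hij : i ≠ j) :
    ¬ (C i j = C i i ∧ C j i = C i i ∧ C j j = C i i) := by
  rintro ⟨h1, h2, h3⟩
  have hp := h.diag_pos hdet i
  -- Rows i and j of the whole matrix agree: in each column, `mul_le_mul_diag` through i and through
  -- j gives the two inequalities.
  refine hdet (Matrix.det_zero_of_row_eq hij (funext fun k => le_antisymm ?_ ?_))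
  · have := h.mul_le_mul_diag j i k
    rw [h2, mul_comm] at this
    exact le_of_mul_le_mul_right this hp
  · have := h.mul_le_mul_diag i j k
    rw [h1, h3, mul_comm] at this
    exact le_of_mul_le_mul_right this hp

/-! ### Total nonnegativity -/

theorem TotallyNonneg.markov (hT : TotallyNonneg C) (h : GeneralizedUltrametric C) :
    Markov C := by
  intro i j k hij hjk
  refine ⟨le_antisymm ?_ (h.mul_le_mul_diag i j k), le_antisymm ?_ (h.mul_le_mul_diag k j i)⟩
  · have := hT 2 ![i, j] ![j, k] (by simpa [Fin.strictMono_iff_lt_succ] using hij)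
      (by simpa [Fin.strictMono_iff_lt_succ] using hjk)
    rw [Matrix.det_fin_two] at this
    simpa using this
  · have := hT 2 ![j, k] ![i, j] (by simpa [Fin.strictMono_iff_lt_succ] using hjk)
      (by simpa [Fin.strictMono_iff_lt_succ] using hij)
    rw [Matrix.det_fin_two] at this
    simp at this
    linarith

/-- A determinant whose first row is proportional to the second one except for the first entry. -/
theorem det_nonneg_of_row {k : ℕ} (A : Matrix (Fin (k + 2)) (Fin (k + 2)) ℝ) (x : ℝ)
    (h0 : x * A 1 0 ≤ A 0 0) (h : ∀ j : Fin (k + 1), A 0 j.succ = x * A 1 j.succ)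
    (hm : 0 ≤ (A.submatrix Fin.succ Fin.succ).det) : 0 ≤ A.det := by
  have hd : (A.updateRow 0 (A 0 + (-x) • A 1)).det = A.det :=
    Matrix.det_updateRow_add_smul_self A (by simp) (-x)
  rw [← hd, Matrix.det_succ_row_zero, Fin.sum_univ_succ, Finset.sum_eq_zero, add_zero]
  · have : (A.updateRow 0 (A 0 + (-x) • A 1)).submatrix Fin.succ (Fin.succAbove 0)
        = A.submatrix Fin.succ Fin.succ := by
      ext i j; simp [Matrix.updateRow_apply]
    rw [this]
    refine mul_nonneg ?_ hm
    simp
    linarith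
  · intro j _
    simp [h j]

/-- If `r 1 ≤ c 1`, every column after the first is at or to the right of `r 1`, where the relations
make row `r 0` proportional to row `r 1`; `mul_le_mul_diag` controls the one remaining entry.
Otherwise columns take the place of rows. -/
theorem Markov.det_submatrix_nonneg (hM : Markov C) (h : GeneralizedUltrametric C)
    (hpos : ∀ i, 0 < C i i) (k : ℕ) :
    ∀ (r c : Fin k → Fin n), StrictMono r → StrictMono c → 0 ≤ (C.submatrix r c).det := by
  induction k with
  | zero => intro r c _ _; simp
  | succ k ih =>
    intro r c hr hc
    rcases k with _ | k
    · simpa [Matrix.det_fin_one] using h.nonneg _ _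
    have hm := ih (r ∘ Fin.succ) (c ∘ Fin.succ) (hr.comp (Fin.strictMono_succ))
      (hc.comp (Fin.strictMono_succ))
    have h01 : (0 : Fin (k + 2)) < 1 := Fin.zero_lt_one
    rcases le_total (r 1) (c 1) with hle | hle
    · have hp := hpos (r 1)
      refine det_nonneg_of_row _ (C (r 0) (r 1) / C (r 1) (r 1)) ?_ ?_ hm
      · have := h.mul_le_mul_diag (r 0) (r 1) (c 0)
        simp only [Matrix.submatrix_apply]
        rw [div_mul_eq_mul_div, div_le_iff₀ hp]; exact this
      · intro j
        simp only [Matrix.submatrix_apply]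
        rw [div_mul_eq_mul_div, eq_div_iff hp.ne']
        have h2 : r 1 ≤ c j.succ := hle.trans (hc.monotone (Fin.le_def.2 (by simp)))
        rcases h2.eq_or_lt with h3 | h3
        · rw [← h3]
        · exact (hM _ _ _ (hr h01) h3).1
    · have hp := hpos (c 1)
      rw [← Matrix.det_transpose]
      refine det_nonneg_of_row _ (C (c 1) (c 0) / C (c 1) (c 1)) ?_ ?_ ?_
      · have := h.mul_le_mul_diag (r 0) (c 1) (c 0)
        simp only [Matrix.submatrix_apply, Matrix.transpose_apply]
        rw [div_mul_eq_mul_div, div_le_iff₀ hp]; linarith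
      · intro j
        simp only [Matrix.submatrix_apply, Matrix.transpose_apply]
        rw [div_mul_eq_mul_div, eq_div_iff hp.ne', mul_comm (C (c 1) (c 0))]
        have h2 : c 1 ≤ r j.succ := hle.trans (hr.monotone (Fin.le_def.2 (by simp)))
        rcases h2.eq_or_lt with h3 | h3
        · rw [← h3, mul_comm]
        · exact (hM _ _ _ (hc h01) h3).2
      · rw [← Matrix.det_transpose]
        exact hm

/-! ### Tridiagonal inverses -/

/-- Truncate column j of the inverse to the indices before k. Its image under C is a multiple of
column k of C, so subtracting a multiple of the k-th unit vector gives a kernel vector. That vector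
is zero, and its i-th entry is the one wanted. -/
theorem Markov.inv_apply_eq_zero (hM : Markov C) (hdet : C.det ≠ 0) (hpos : ∀ i, C i i ≠ 0)
    {i k j : Fin n} (hik : i < k) (hkj : k < j) : C⁻¹ i j = 0 := by
  set x : Fin n → ℝ := fun l => C⁻¹ l j with hx
  have hCx : ∀ p, p < j → ∑ l, C p l * x l = 0 := by
    intro p hp
    have h := congrFun (congrFun (Matrix.mul_nonsing_inv C (isUnit_iff_ne_zero.2 hdet)) p) j
    rwa [Matrix.mul_apply, Matrix.one_apply_ne hp.ne] at h
  set s : Fin n → ℝ := fun p => ∑ l, C p l * (if l < k then x l else 0) with hs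
  have key : ∀ p, s p * C k k = C p k * s k := by
    intro p
    rcases lt_trichotomy p k with hp | rfl | hp
    · have h1 : ∀ q, q < j → s q = - ∑ l, C q l * (if l < k then 0 else x l) := by
        intro q hq
        rw [eq_neg_iff_add_eq_zero, ← Finset.sum_add_distrib]
        refine (Finset.sum_congr rfl fun l _ => ?_).trans (hCx q hq)
        split_ifs <;> ring
      rw [h1 p (hp.trans hkj), h1 k hkj, neg_mul, mul_neg, Finset.sum_mul, Finset.mul_sum]
      congr 1
      refine Finset.sum_congr rfl fun l _ => ?_
      split_ifs with hl
      · simp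
      · rcases (not_lt.1 hl).eq_or_lt with rfl | hl
        · ring
        · linear_combination x l * (hM p k l hp hl).1
    · ring
    · simp only [hs]
      rw [Finset.sum_mul, Finset.mul_sum]
      refine Finset.sum_congr rfl fun l _ => ?_
      split_ifs with hl
      · linear_combination x l * (hM l k p hl hp).2
      · simp
  set z : Fin n → ℝ := fun l => (if l < k then x l else 0) + if l = k then - s k / C k k else 0
    with hz
  have hCz : C.mulVec z = 0 := by
    funext p
    have hkk := hpos k
    have h1 : C.mulVec z p = s p + C p k * (- s k / C k k) := by
      simp only [Matrix.mulVec, dotProduct, hz, hs, mul_add, Finset.sum_add_distrib, mul_ite,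
        mul_zero, Finset.sum_ite_eq', Finset.mem_univ, if_true]
    rw [h1, Pi.zero_apply]
    field_simp
    linarith [key p]
  have hz0 : z = 0 := Matrix.eq_zero_of_mulVec_eq_zero hdet hCz
  have := congrFun hz0 i
  simpa [hz, hik, hik.ne] using this

theorem Markov.tridiagonal_inv (hM : Markov C) (hdet : C.det ≠ 0) (hpos : ∀ i, C i i ≠ 0) :
    Tridiagonal C⁻¹ := by
  rintro i j (h | h)
  · let k : Fin n := ⟨i + 1, by omega⟩
    exact hM.inv_apply_eq_zero hdet hpos (k := k) (Fin.lt_def.2 (by simp [k]))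
      (Fin.lt_def.2 (by simpa [k] using h))
  · let k : Fin n := ⟨j + 1, by omega⟩
    have := hM.transpose.inv_apply_eq_zero (by rwa [Matrix.det_transpose]) hpos
      (k := k) (i := j) (j := i) (Fin.lt_def.2 (by simp [k])) (Fin.lt_def.2 (by simpa [k] using h))
    rwa [← Matrix.transpose_nonsing_inv] at this

/-- The vector v is a combination of columns j and k of C vanishing at row j, truncated before j.
Tridiagonality confines `C⁻¹ v` to position j, so v is a multiple of column j; as v vanishes at j
and the diagonal does not, v = 0. -/
theorem mul_eq_mul_of_tridiagonal_inv (hdet : C.det ≠ 0) (hpos : ∀ i, C i i ≠ 0)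
    (hT : Tridiagonal C⁻¹) {i j k : Fin n} (hij : i < j) (hjk : j < k) :
    C i k * C j j = C i j * C j k := by
  set v : Fin n → ℝ := fun l => if l < j then C l j * C j k - C l k * C j j else 0 with hv
  have hTC : ∀ p q, p ≠ q → ∑ l, C⁻¹ p l * C l q = 0 := by
    intro p q hpq
    have h := congrFun (congrFun (Matrix.nonsing_inv_mul C (isUnit_iff_ne_zero.2 hdet)) p) q
    rwa [Matrix.mul_apply, Matrix.one_apply_ne hpq] at h
  have hTv : ∀ p, p ≠ j → C⁻¹.mulVec v p = 0 := by
    intro p hp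
    simp only [Matrix.mulVec, dotProduct, hv]
    rcases hp.lt_or_gt with hp | hp
    · have h1 := hTC p j hp.ne
      have h2 := hTC p k (hp.trans hjk).ne
      have h3 : ∑ l, C⁻¹ p l * (C l j * C j k - C l k * C j j) = 0 := by
        have : ∑ l, C⁻¹ p l * (C l j * C j k - C l k * C j j) =
            (∑ l, C⁻¹ p l * C l j) * C j k - (∑ l, C⁻¹ p l * C l k) * C j j := by
          rw [Finset.sum_mul, Finset.sum_mul, ← Finset.sum_sub_distrib]
          exact Finset.sum_congr rfl fun l _ => by ring
        rw [this, h1, h2]; ring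
      refine (Finset.sum_congr rfl fun l _ => ?_).trans h3
      split_ifs with hl
      · rfl
      -- Row p < j of the inverse reaches no further than j, and the term at j cancels by itself, so
      -- the truncation loses nothing.
      · rcases (not_lt.1 hl).eq_or_lt with rfl | hl
        · ring
        · rw [hT p l (Or.inl (by have := Fin.lt_def.1 hl; have := Fin.lt_def.1 hp; omega))]
          ring
    · refine Finset.sum_eq_zero fun l _ => ?_
      split_ifs with hl
      · rw [hT p l (Or.inr (by have := Fin.lt_def.1 hl; have := Fin.lt_def.1 hp; omega)), zero_mul]
      · simp
  have hvC : ∀ p, v p = C p j * C⁻¹.mulVec v j := by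
    intro p
    have h : C.mulVec (C⁻¹.mulVec v) = v := by
      rw [Matrix.mulVec_mulVec, Matrix.mul_nonsing_inv C (isUnit_iff_ne_zero.2 hdet),
        Matrix.one_mulVec]
    have h' : ∑ l, C p l * C⁻¹.mulVec v l = v p := congrFun h p
    rw [← h', Finset.sum_eq_single j]
    · intro l _ hl; rw [hTv l hl, mul_zero]
    · simp
  have h0 : C⁻¹.mulVec v j = 0 := by
    have := hvC j
    simp only [hv, lt_irrefl, if_false] at this
    exact (mul_eq_zero.1 this.symm).resolve_left (hpos j)
  have := hvC i
  rw [h0, mul_zero] at this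
  simp only [hv, hij, if_true] at this
  linarith

theorem Tridiagonal.markov (hT : Tridiagonal C⁻¹) (hdet : C.det ≠ 0)
    (hpos : ∀ i, C i i ≠ 0) : Markov C := by
  intro i j k hij hjk
  refine ⟨mul_eq_mul_of_tridiagonal_inv hdet hpos hT hij hjk, ?_⟩
  have hT' : Tridiagonal C.transpose⁻¹ := by
    intro i j h
    rw [← Matrix.transpose_nonsing_inv]
    exact hT j i h.symm
  have := mul_eq_mul_of_tridiagonal_inv (C := C.transpose) (by rwa [Matrix.det_transpose]) hpos hT' hij hjk
  simp only [Matrix.transpose_apply] at this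
  rw [this, mul_comm]

end Cyclops

/-! ### Zeros and triples over an arbitrary linear order -/

namespace Cyclops

section Order

variable {ι : Type*} [LinearOrder ι]

/-- The pointwise properties of a nonsingular generalized ultrametric matrix with tridiagonal
inverse, for an index set that is an arbitrary linear order. -/
structure UltraMarkov (c : ι → ι → ℝ) : Prop where
  pos : ∀ i, 0 < c i i
  nonneg : ∀ i j, 0 ≤ c i j
  le_row : ∀ i j, c i j ≤ c i i
  le_col : ∀ i j, c i j ≤ c j j
  isosceles : ∀ i j k, i < j → j < k → Isosceles c i j k ∨ Isosceles c j i k ∨ Isosceles c k i j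
  markov : Markov c
  not_flat : ∀ i j, i < j → ¬ (c i j = c i i ∧ c j i = c i i ∧ c j j = c i i)

/-- The matrix transposed along its secondary diagonal. -/
def flip (c : ι → ι → ℝ) : ιᵒᵈ → ιᵒᵈ → ℝ :=
  fun i j => c (OrderDual.ofDual j) (OrderDual.ofDual i)

namespace UltraMarkov

variable {c : ι → ι → ℝ}

theorem transpose (h : UltraMarkov c) : UltraMarkov (fun i j => c j i) where
  pos := h.pos
  nonneg i j := h.nonneg j i
  le_row i j := h.le_col j i
  le_col i j := h.le_row j i
  isosceles i j k hij hjk :=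
    (h.isosceles i j k hij hjk).imp Isosceles.transpose
      (Or.imp Isosceles.transpose Isosceles.transpose)
  markov i j k hij hjk := by
    obtain ⟨h1, h2⟩ := h.markov i j k hij hjk
    exact ⟨by linarith, by linarith⟩
  not_flat i j hij := fun ⟨h1, h2, h3⟩ => h.not_flat i j hij ⟨h2, h1, h3⟩

/-- Entries above the diagonal stay above it while rows and columns are exchanged; facts about
columns left of a cut thus become facts about rows right of it. -/
theorem flip (h : UltraMarkov c) : UltraMarkov (flip c) where
  pos i := h.pos i.ofDual
  nonneg i j := h.nonneg _ _
  le_row i j := h.le_col _ _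
  le_col i j := h.le_row _ _
  isosceles i j k hij hjk := by
    rcases h.isosceles k.ofDual j.ofDual i.ofDual hjk hij with h1 | h1 | h1
    · exact Or.inr (Or.inr h1.symm.transpose)
    · exact Or.inr (Or.inl h1.symm.transpose)
    · exact Or.inl h1.symm.transpose
  markov i j k hij hjk := by
    obtain ⟨h1, h2⟩ := h.markov k.ofDual j.ofDual i.ofDual hjk hij
    exact ⟨h1.trans (mul_comm _ _), h2.trans (mul_comm _ _)⟩
  not_flat i j hij := fun ⟨h1, h2, h3⟩ =>
    h.not_flat j.ofDual i.ofDual hij ⟨h1.trans h3.symm, h2.trans h3.symm, h3.symm⟩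

theorem lower_zero (h : UltraMarkov c) {i j k : ι} (hij : i < j) (hjk : j < k)
    (h0 : c k j = 0 ∨ c j i = 0) : c k i = 0 := by
  have h1 := (h.markov i j k hij hjk).2
  have h2 : c k i * c j j = 0 := by rw [h1]; exact mul_eq_zero.2 h0
  exact (mul_eq_zero.1 h2).resolve_right (h.pos j).ne'

theorem lower_zero' (h : UltraMarkov c) {i j k : ι} (hij : i < j) (hjk : j < k)
    (h0 : c k i = 0) : c k j = 0 ∨ c j i = 0 := by
  have h1 := (h.markov i j k hij hjk).2
  rw [h0, zero_mul] at h1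
  exact mul_eq_zero.1 h1.symm

/-- A pair of indices with vanishing lower entry is separated by an index whose row vanishes to
the left of the diagonal. -/
theorem exists_start [Finite ι] (h : UltraMarkov c) {i j : ι} (hij : i < j) (h0 : c j i = 0) :
    ∃ s, i < s ∧ s ≤ j ∧ ∀ k < s, c s k = 0 := by
  -- The least index after i with a zero in column i. Indices strictly between i and s have no such
  -- zero, so the zero `c s i` must come from row s.
  obtain ⟨s, ⟨his, hs⟩, hmin⟩ :=
    (Set.toFinite {k | i < k ∧ c k i = 0}).exists_minimal ⟨j, hij, h0⟩
  replace hmin : ∀ k, i < k → c k i = 0 → s ≤ k := fun k h1 h2 =>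
    (le_total s k).elim id (hmin ⟨h1, h2⟩)
  refine ⟨s, his, hmin j hij h0, fun k hk => ?_⟩
  rcases lt_trichotomy k i with hki | rfl | hki
  · exact h.lower_zero hki his (Or.inl hs)
  · exact hs
  · exact (h.lower_zero' hki hk hs).resolve_right fun h1 => (hmin k hki h1).not_gt hk

/-- If the column of `k` vanishes above the diagonal and the row of `l < k` vanishes to the left of
the diagonal, then the matrix splits as a direct sum. -/
theorem exists_cut_of_lt [Finite ι] (h : UltraMarkov c) {i k l : ι} (hil : i < l) (hlk : l < k)
    (hk : ∀ a < k, c a k = 0) (hl : ∀ a < l, c l a = 0) :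
    ∃ j, i < j ∧ ∀ a b, a < j → j ≤ b → c a b = 0 ∧ c b a = 0 := by
  have hT := h.transpose
  -- The direct sum splits at the first nonzero entry of row k; it lies to the right of i because
  -- the zeros in row l force row k to vanish before l.
  obtain ⟨j, hj, hmin⟩ := (Set.toFinite {j | c k j ≠ 0}).exists_minimal ⟨k, (h.pos k).ne'⟩
  replace hmin : ∀ a < j, c k a = 0 := fun a ha => by
    by_contra h1
    exact (hmin h1 ha.le).not_gt ha
  have hjk : j ≤ k := by
    by_contra h1
    exact (h.pos k).ne' (hmin k (not_le.1 h1))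
  have hij : i < j := by
    by_contra h1
    exact hj (h.lower_zero ((not_lt.1 h1).trans_lt hil) hlk (Or.inr (hl _ ((not_lt.1 h1).trans_lt hil))))
  have hlow : ∀ a < j, c j a = 0 := by
    intro a ha
    rcases hjk.eq_or_lt with rfl | hjk
    · exact hmin a ha
    · exact (h.lower_zero' ha hjk (hmin a ha)).resolve_left hj
  have hup : ∀ a < j, c a j = 0 := by
    intro a ha
    rcases hjk.eq_or_lt with rfl | hjk
    · exact hk a ha
    · have h1 := hlow a ha
      have h2 := hmin a ha
      have h3 := hk j hjk
      have h4 := hk a (ha.trans hjk)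
      -- Of the six off-diagonal entries of this triple, only `c k j` is known to be nonzero and
      -- only `c a j` is undecided; each labeling forces the latter to vanish or is contradictory.
      rcases h.isosceles a j k ha hjk with ⟨h5, -⟩ | ⟨-, h5, -, h6⟩ | ⟨h5, -⟩
      · rw [h5, h4]
      · rw [h1, h2, h4, max_self] at h6
        exact le_antisymm ((le_max_left _ _).trans h6) (h.nonneg _ _)
      · exact absurd (h5.symm.trans h2) hj
  refine ⟨j, hij, fun a b ha hb => ?_⟩
  rcases hb.eq_or_lt with rfl | hb
  · exact ⟨hup a ha, hlow a ha⟩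
  · exact ⟨hT.lower_zero ha hb (Or.inr (hup a ha)), h.lower_zero ha hb (Or.inr (hlow a ha))⟩

/-- If there are zeros on both sides of the diagonal then the matrix splits as a direct sum. -/
theorem exists_cut [Finite ι] (h : UltraMarkov c) {i j k l : ι} (hij : i < j) (h0 : c i j = 0)
    (hkl : k < l) (h1 : c l k = 0) :
    ∃ s t, t < s ∧ ∀ a b, a < s → s ≤ b → c a b = 0 ∧ c b a = 0 := by
  obtain ⟨s, his, -, hs⟩ := h.transpose.exists_start hij h0
  obtain ⟨t, hkt, -, ht⟩ := h.exists_start hkl h1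
  rcases lt_trichotomy t s with hts | rfl | hts
  · obtain ⟨r, h2, h3⟩ := h.exists_cut_of_lt hkt hts hs ht
    exact ⟨r, k, h2, h3⟩
  · refine ⟨t, k, hkt, fun a b ha hb => ?_⟩
    rcases hb.eq_or_lt with rfl | hb
    · exact ⟨hs a ha, ht a ha⟩
    · exact ⟨h.transpose.lower_zero ha hb (Or.inr (hs a ha)), h.lower_zero ha hb (Or.inr (ht a ha))⟩
  · obtain ⟨r, h2, h3⟩ := h.transpose.exists_cut_of_lt his hts ht hs
    exact ⟨r, i, h2, fun a b ha hb => (h3 a b ha hb).symm⟩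

/-- The two possible shapes of an ordered triple of indices, if no entry above the diagonal
vanishes. -/
theorem triple (h : UltraMarkov c) (hup : ∀ i j, i < j → 0 < c i j) {i j k : ι} (hij : i < j)
    (hjk : j < k) :
    (c i j = c i k ∧ c j i = c k i ∧ c j k = c j j ∧ (c j i = 0 ∨ c k j = c j j)) ∨
    (c i k = c j k ∧ c k i = c k j ∧ c i j = c j j ∧ (c k j = 0 ∨ c j i = c j j)) := by
  obtain ⟨h1, h2⟩ := h.markov i j k hij hjk
  have hpij := hup i j hij
  have hpjk := hup j k hjk
  have first : Isosceles c i j k → (c i j = c i k ∧ c j i = c k i ∧ c j k = c j j ∧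
      (c j i = 0 ∨ c k j = c j j)) := by
    rintro ⟨h3, h4, -, -⟩
    refine ⟨h3, h4, ?_, ?_⟩
    · rw [← h3] at h1
      exact (mul_left_cancel₀ hpij.ne' h1).symm
    · rw [← h4, mul_comm] at h2
      rcases eq_or_ne (c j i) 0 with h5 | h5
      · exact Or.inl h5
      · exact Or.inr (mul_right_cancel₀ h5 h2).symm
  rcases h.isosceles i j k hij hjk with h3 | ⟨h3, h4, -, h5⟩ | ⟨h3, h4, -, -⟩
  · exact Or.inl (first h3)
  -- With j distinguished, the two relations give `c k i = c i k`. The inequality of maxima then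
  -- forces `c i j`, `c j k` and `c i k` all to equal `c j j`, which is a case of the second shape.
  · have hj := h.pos j
    have h6 : c k i = c i k := by
      refine mul_right_cancel₀ hj.ne' ?_
      rw [h2, h1, h3, h4, mul_comm]
    rw [h6, max_self] at h5
    have hy : c j k = c j j := by
      refine le_antisymm (h.le_row j k) (le_of_mul_le_mul_left ?_ hpij)
      rw [← h1]
      exact mul_le_mul_of_nonneg_right ((le_max_left _ _).trans h5) hj.le
    have hx : c i j = c j j := by
      refine le_antisymm (h.le_col i j) (le_of_mul_le_mul_right ?_ hpjk)
      rw [← h1, mul_comm, ← h3]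
      exact mul_le_mul_of_nonneg_right ((le_max_right _ _).trans h5) hj.le
    have hz : c i k = c j j := by
      refine mul_right_cancel₀ hj.ne' ?_
      rw [h1, hx, hy]
    right
    exact ⟨hz.trans hy.symm, by rw [h6, hz, ← h4, hx], hx, Or.inr (h3.trans hy)⟩
  · right
    refine ⟨h4, h3, ?_, ?_⟩
    · rw [h4, mul_comm] at h1
      exact (mul_right_cancel₀ hpjk.ne' h1).symm
    · rw [h3] at h2
      rcases eq_or_ne (c k j) 0 with h5 | h5
      · exact Or.inl h5
      · exact Or.inr (mul_left_cancel₀ h5 h2).symm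

end UltraMarkov
end Order
end Cyclops

/-! ### Existence of the cut between flat columns and flat rows -/

namespace Cyclops

section Order

variable {ι : Type*} [LinearOrder ι] {c : ι → ι → ℝ}

namespace UltraMarkov

/-- Every index is flat in its column above the diagonal or in its row right of the diagonal. -/
theorem col_or_row (h : UltraMarkov c) (hup : ∀ i j, i < j → 0 < c i j) (j : ι) :
    (∀ i < j, c i j = c j j) ∨ ∀ k, j < k → c j k = c j j := by
  by_contra! hcon
  obtain ⟨⟨i, hij, h1⟩, k, hjk, h2⟩ := hcon
  rcases h.triple hup hij hjk with h3 | h3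
  · exact h2 h3.2.2.1
  · exact h1 h3.2.2.1

/-- An index which is not flat in its row comes before every index which is not flat in its
column. -/
theorem lt_of_not_row_of_not_col (h : UltraMarkov c) (hup : ∀ i j, i < j → 0 < c i j) {i j : ι}
    (hj : ¬ ∀ k, j < k → c j k = c j j) (hi : ¬ ∀ k < i, c k i = c i i) : j < i := by
  have hj' := (h.col_or_row hup j).resolve_right hj
  have hi' := (h.col_or_row hup i).resolve_left hi
  by_contra hle
  rcases (not_lt.1 hle).eq_or_lt with rfl | hij
  · exact hi hj'
  -- The entry `c i j` is at once the row value of i and the column value of j; flatness of column j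
  -- then passes to column i.
  · have h2 : c i i = c j j := (hi' j hij).symm.trans (hj' i hij)
    refine hi fun k hk => ?_
    have h1 := (h.markov k i j hk hij).1
    rw [hj' k (hk.trans hij), hj' i hij, mul_comm] at h1
    exact (mul_right_cancel₀ (h.pos j).ne' h1).symm

/-- `P` is an initial segment at which the block form changes from flat columns to flat rows. -/
structure IsCut (c : ι → ι → ℝ) (P : ι → Prop) : Prop where
  lower : ∀ i j, i < j → P j → P i
  nonempty : ∃ i, P i
  nonempty_compl : ∃ i, ¬ P i
  col : ∀ j, P j → ∀ i < j, c i j = c j j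
  row : ∀ j, ¬ P j → ∀ k, j < k → c j k = c j j
  zero : ∀ i j, P i → ¬ P j → c j i = 0

theorem IsCut.of_flip {P : ιᵒᵈ → Prop} (hP : IsCut (Cyclops.flip c) P) :
    IsCut c (fun i => ¬ P (OrderDual.toDual i)) where
  lower i j hij hj hi := hj (hP.lower (OrderDual.toDual j) (OrderDual.toDual i) hij hi)
  nonempty := hP.nonempty_compl
  nonempty_compl := hP.nonempty.imp fun i hi => not_not.2 hi
  col j hj i hij := hP.row (OrderDual.toDual j) hj (OrderDual.toDual i) hij
  row j hj k hjk := hP.col (OrderDual.toDual j) (not_not.1 hj) (OrderDual.toDual k) hjk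
  zero i j hi hj := hP.zero (OrderDual.toDual j) (OrderDual.toDual i) (not_not.1 hj) hi

/-- The cut is placed just before the first index a whose column is not flat. Since the earlier
columns are flat, the entries above `c a a` are all equal, hence all different from it. A triple i <
a < k₀ therefore has the first shape, and `c k₀ a = 0` forces `c a i = 0`. Rows from a on are flat
by `lt_of_not_row_of_not_col`. -/
theorem exists_isCut_of_not_col [Finite ι] (h : UltraMarkov c) (hup : ∀ i j, i < j → 0 < c i j)
    {a₀ k₀ : ι} (ha₀ : ¬ ∀ i < a₀, c i a₀ = c a₀ a₀) (hak : a₀ < k₀) (hz : c k₀ a₀ = 0) :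
    ∃ P, IsCut c P := by
  obtain ⟨a, ha, hmin⟩ := (Set.toFinite {a | ¬ ∀ i < a, c i a = c a a}).exists_minimal ⟨a₀, ha₀⟩
  replace ha : ¬ ∀ i < a, c i a = c a a := ha
  replace hmin : ∀ j, (¬ ∀ i < j, c i j = c j j) → a ≤ j := fun k h1 =>
    (le_total a k).elim id (hmin h1)
  have haa := hmin a₀ ha₀
  have hcol : ∀ j < a, ∀ i < j, c i j = c j j := fun j hj => by
    by_contra h1
    exact (hmin j h1).not_gt hj
  have hka : c k₀ a = 0 := by
    rcases haa.eq_or_lt with h1 | h1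
    · rw [h1]; exact hz
    · exact h.lower_zero h1 hak (Or.inl hz)
  have hne : ∀ i < a, c i a ≠ c a a := by
    intro i hi
    obtain ⟨b, hb, hba⟩ : ∃ b < a, c b a ≠ c a a := by simpa using ha
    have : c i a = c b a := by
      rcases lt_trichotomy i b with h1 | rfl | h1
      · have h2 := (h.markov i b a h1 hb).1
        rw [hcol b hb i h1, mul_comm] at h2
        exact mul_left_cancel₀ (h.pos b).ne' h2
      · rfl
      · have h2 := (h.markov b i a h1 hi).1
        rw [hcol i hi b h1, mul_comm] at h2
        exact (mul_left_cancel₀ (h.pos i).ne' h2).symm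
    rwa [this]
  have hlow : ∀ i < a, c a i = 0 := by
    intro i hi
    rcases h.triple hup hi (haa.trans_lt hak) with h1 | h1
    · refine h1.2.2.2.resolve_right fun h2 => (h.pos a).ne' ?_
      rw [← h2, hka]
    · exact absurd h1.2.2.1 (hne i hi)
  obtain ⟨b, hb, hba⟩ : ∃ b < a, c b a ≠ c a a := by simpa using ha
  refine ⟨fun i => i < a, fun i j hij hj => hij.trans hj, ⟨b, hb⟩, ⟨a, lt_irrefl a⟩, hcol, ?_, ?_⟩
  · intro j hj
    by_contra h1
    exact hj (h.lt_of_not_row_of_not_col hup h1 ha)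
  · intro i j hi hj
    rcases (not_lt.1 hj).eq_or_lt with rfl | hj
    · exact hlow i hi
    · exact h.lower_zero hi hj (Or.inr (hlow i hi))

/-- The first candidate P ends with the last index having a nonzero entry in column i₀. If a column
inside P or a row outside P fails to be flat, `exists_isCut_of_not_col` or its flip gives a cut
elsewhere; otherwise P itself is one. -/
theorem exists_isCut [Finite ι] (h : UltraMarkov c) (hup : ∀ i j, i < j → 0 < c i j)
    {i₀ j₀ : ι} (hij : i₀ < j₀) (hz : c j₀ i₀ = 0) : ∃ P, IsCut c P := by
  set P : ι → Prop := fun i => i ≤ i₀ ∨ c i i₀ ≠ 0 with hP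
  have hnot : ∀ j, ¬ P j → i₀ < j ∧ c j i₀ = 0 := fun j hj => by
    simpa only [hP, not_or, not_le, not_not] using hj
  have hmem : ∀ a, P a → a < j₀ ∧ c j₀ a = 0 := by
    rintro a (ha | ha)
    · refine ⟨ha.trans_lt hij, ?_⟩
      rcases ha.eq_or_lt with rfl | ha
      · exact hz
      · exact h.lower_zero ha hij (Or.inl hz)
    · have haj : a < j₀ := by
        by_contra h1
        rcases (not_lt.1 h1).eq_or_lt with rfl | h1
        · exact ha hz
        · exact ha (h.lower_zero hij h1 (Or.inr hz))
      refine ⟨haj, ?_⟩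
      rcases lt_trichotomy i₀ a with h1 | rfl | h1
      · exact (h.lower_zero' h1 haj hz).resolve_right ha
      · exact hz
      · exact h.lower_zero h1 hij (Or.inl hz)
  by_cases h1 : ∃ a, P a ∧ ¬ ∀ i < a, c i a = c a a
  · obtain ⟨a, ha, ha'⟩ := h1
    obtain ⟨h3, h4⟩ := hmem a ha
    exact h.exists_isCut_of_not_col hup ha' h3 h4
  by_cases h2 : ∃ b, ¬ P b ∧ ¬ ∀ k, b < k → c b k = c b b
  · obtain ⟨b, hb, hb'⟩ := h2
    obtain ⟨h3, h4⟩ := hnot b hb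
    obtain ⟨Q, hQ⟩ := h.flip.exists_isCut_of_not_col (fun i j hij => hup _ _ hij)
      (a₀ := OrderDual.toDual b) (k₀ := OrderDual.toDual i₀) hb' h3 h4
    exact ⟨_, hQ.of_flip⟩
  push Not at h1 h2
  refine ⟨P, ?_, ⟨i₀, Or.inl le_rfl⟩, ⟨j₀, ?_⟩, h1, h2, ?_⟩
  · intro i j hij hj
    by_contra hi
    obtain ⟨h3, h4⟩ := hnot i hi
    rcases hj with hj | hj
    · exact (h3.trans (hij.trans_le hj)).false
    · exact hj (h.lower_zero h3 hij (Or.inr h4))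
  · simp [hP, hij, hz]
  · intro i j hi hj
    obtain ⟨h3, h4⟩ := hnot j hj
    rcases lt_trichotomy i i₀ with h5 | rfl | h5
    · exact h.lower_zero h5 h3 (Or.inl h4)
    · exact h4
    · have hij' : i < j := by
        by_contra h6
        rcases (not_lt.1 h6).eq_or_lt with rfl | h6
        · exact hj hi
        · exact (hi.resolve_left (not_le.2 h5)) (h.lower_zero h3 h6 (Or.inr h4))
      exact (h.lower_zero' h5 hij' h4).resolve_right (hi.resolve_left (not_le.2 h5))

end UltraMarkov
end Order
end Cyclops

/-! ### Entries on either side of the cut, and the numbering of the blocks -/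

namespace Cyclops

section Order

variable {ι : Type*} [LinearOrder ι] {c : ι → ι → ℝ} {P : ι → Prop}

namespace UltraMarkov

theorem IsCut.lt (hP : IsCut c P) {i j : ι} (hi : P i) (hj : ¬ P j) : i < j := by
  by_contra h
  rcases (not_lt.1 h).eq_or_lt with rfl | h
  · exact hj hi
  · exact hj (hP.lower _ _ h hi)

theorem IsCut.flip (hP : IsCut c P) :
    IsCut (Cyclops.flip c) (fun i => ¬ P (OrderDual.ofDual i)) where
  lower i j hij hj hi := hj (hP.lower (OrderDual.ofDual j) (OrderDual.ofDual i) hij hi)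
  nonempty := hP.nonempty_compl
  nonempty_compl := hP.nonempty.imp fun i hi => not_not.2 hi
  col j hj i hij := hP.row (OrderDual.ofDual j) hj (OrderDual.ofDual i) hij
  row j hj k hjk := hP.col (OrderDual.ofDual j) (not_not.1 hj) (OrderDual.ofDual k) hjk
  zero i j hi hj := hP.zero (OrderDual.ofDual j) (OrderDual.ofDual i) (not_not.1 hj) hi

theorem IsCut.diag_le (hP : IsCut c P) (h : UltraMarkov c) {i j : ι} (hij : i ≤ j) (hj : P j) :
    c j j ≤ c i i := by
  rcases hij.eq_or_lt with rfl | hij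
  · exact le_rfl
  · rw [← hP.col j hj i hij]; exact h.le_row i j

theorem IsCut.corner_left (hP : IsCut c P) (h : UltraMarkov c) {i i' j : ι} (hii : i ≤ i')
    (hi : P i') (hj : ¬ P j) : c i j = c i' j := by
  rcases hii.eq_or_lt with rfl | hii
  · rfl
  · have h1 := (h.markov i i' j hii (hP.lt hi hj)).1
    rw [hP.col i' hi i hii, mul_comm] at h1
    exact mul_left_cancel₀ (h.pos i').ne' h1

theorem IsCut.corner (hP : IsCut c P) (h : UltraMarkov c) {i i' j j' : ι} (hi : P i) (hi' : P i')
    (hj : ¬ P j) (hj' : ¬ P j') : c i j = c i' j' := by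
  have h1 : c i j = c i' j := by
    rcases le_total i i' with h1 | h1
    · exact hP.corner_left h h1 hi' hj
    · exact (hP.corner_left h h1 hi hj).symm
  have h2 : c i' j = c i' j' := by
    rcases le_total j j' with h1 | h1
    · exact (hP.flip.corner_left h.flip (i := OrderDual.toDual j') (i' := OrderDual.toDual j)
        (j := OrderDual.toDual i') h1 hj (not_not.2 hi')).symm
    · exact hP.flip.corner_left h.flip (i := OrderDual.toDual j) (i' := OrderDual.toDual j')
        (j := OrderDual.toDual i') h1 hj' (not_not.2 hi')
  rw [h1, h2]

/-- The first shape of `triple` would make the principal submatrix on j, k flat, so the second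
holds; equal diagonal entries at i and j would then make the one on i, j flat. -/
theorem IsCut.block_triple (hP : IsCut c P) (h : UltraMarkov c) (hup : ∀ i j, i < j → 0 < c i j)
    {i j k : ι} (hij : i < j) (hjk : j < k) (hk : P k) (h1 : c j i ≠ 0) (h2 : c k j ≠ 0) :
    c k i = c k j ∧ c j i = c j j ∧ c j j < c i i := by
  have e1 := hP.col j (hP.lower _ _ hjk hk) i hij
  have e2 := hP.col k hk i (hij.trans hjk)
  rcases h.triple hup hij hjk with ⟨h3, -, h5, h6⟩ | ⟨-, h4, -, h6⟩
  · refine absurd ⟨h5, h6.resolve_left h1, ?_⟩ (h.not_flat j k hjk)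
    rw [← e2, ← h3, e1]
  · have h6 := h6.resolve_left h2
    refine ⟨h4, h6, lt_of_le_of_ne ?_ fun h7 => h.not_flat i j hij ?_⟩
    · rw [← e1]; exact h.le_row i j
    · exact ⟨e1.trans h7, h6.trans h7, h7⟩

/-- The index a, in an earlier block, excludes the second shape of `triple`, which would carry the
zero `c j a` over to `c j i`. The first shape equates the diagonal entries through row a. -/
theorem IsCut.middle (hP : IsCut c P) (h : UltraMarkov c) (hup : ∀ i j, i < j → 0 < c i j)
    {a i j : ι} (hai : a < i) (hij : i < j) (hj : P j) (h1 : c i a = 0) (h2 : c j i ≠ 0) :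
    c i i = c j j ∧ c j i < c i i ∧ c i j = c i i := by
  have e1 := hP.col i (hP.lower _ _ hij hj) a hai
  have e2 := hP.col j hj a (hai.trans hij)
  have e3 := hP.col j hj i hij
  have h5 : c i i = c j j := by
    rcases h.triple hup hai hij with ⟨h3, -, -, -⟩ | ⟨-, h4, -, -⟩
    · rw [← e1, h3, e2]
    · exact absurd (h4.symm.trans (h.lower_zero hai hij (Or.inr h1))) h2
  refine ⟨h5, lt_of_le_of_ne (h.le_col j i) fun h6 => h.not_flat i j hij ?_, e3.trans h5.symm⟩
  exact ⟨e3.trans h5.symm, h6, h5.symm⟩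

/-- An earlier block makes the diagonal constant (`middle`), whereas a third index makes it drop
strictly (`block_triple`). -/
theorem IsCut.middle_size (hP : IsCut c P) (h : UltraMarkov c) (hup : ∀ i j, i < j → 0 < c i j)
    {a i j k : ι} (hai : a < i) (hij : i < j) (hjk : j < k) (hk : P k) (h1 : c i a = 0)
    (h2 : c j i ≠ 0) (h3 : c k j ≠ 0) : False := by
  have h4 := (hP.middle h hup hai hij (hP.lower _ _ hjk hk) h1 h2).1
  exact (hP.block_triple h hup hij hjk hk h2 h3).2.2.ne' h4

theorem exists_card_filter_le_eq (S : Finset ι) (t : ℕ) (h1 : 1 ≤ t) (h2 : t ≤ S.card) :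
    ∃ s ∈ S, (S.filter (· ≤ s)).card = t := by
  induction S using Finset.induction_on_max with
  | empty => simp at h2; omega
  | insert a S ha ih =>
    have haS : a ∉ S := fun h => (ha a h).false
    rw [Finset.card_insert_of_notMem haS] at h2
    rcases h2.eq_or_lt with h2 | h2
    · refine ⟨a, Finset.mem_insert_self _ _, ?_⟩
      rw [Finset.filter_true_of_mem, Finset.card_insert_of_notMem haS, h2]
      simp only [Finset.mem_insert, forall_eq_or_imp, le_refl, true_and]
      exact fun x hx => (ha x hx).le
    · obtain ⟨s, hs, hs'⟩ := ih (by omega)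
      refine ⟨s, Finset.mem_insert_of_mem hs, ?_⟩
      rw [Finset.filter_insert, if_neg (not_le.2 (ha s hs)), hs']

section Index

variable [Fintype ι]

open Classical in
/-- The indices whose row vanishes to the left of the diagonal. -/
noncomputable def starts (c : ι → ι → ℝ) : Finset ι :=
  Finset.univ.filter fun s => ∀ k < s, c s k = 0

open Classical in
/-- The number of the block of an index. -/
noncomputable def blockIndex (c : ι → ι → ℝ) (i : ι) : ℕ := ((starts c).filter (· ≤ i)).card

theorem mem_starts {s : ι} : s ∈ starts c ↔ ∀ k < s, c s k = 0 := by simp [starts]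

theorem blockIndex_mono : Monotone (blockIndex c) := fun _ _ hij =>
  Finset.card_le_card fun s hs => by
    simp only [Finset.mem_filter] at hs ⊢
    exact ⟨hs.1, hs.2.trans hij⟩

theorem blockIndex_lt (h : UltraMarkov c) {i j : ι} (hij : i < j) (h0 : c j i = 0) :
    blockIndex c i < blockIndex c j := by
  obtain ⟨s, his, hsj, hs⟩ := h.exists_start hij h0
  refine Finset.card_lt_card ((Finset.ssubset_iff_of_subset fun t ht => ?_).2 ⟨s, ?_, ?_⟩)
  · simp only [Finset.mem_filter] at ht ⊢
    exact ⟨ht.1, ht.2.trans hij.le⟩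
  · exact Finset.mem_filter.2 ⟨mem_starts.2 hs, hsj⟩
  · simp [his]

/-- A start after i and up to j has a zero in column i, and `lower_zero` carries it down to row j.
So lying in one block amounts to a nonzero entry below the diagonal. -/
theorem blockIndex_lt_iff (h : UltraMarkov c) {i j : ι} (hij : i < j) :
    blockIndex c i < blockIndex c j ↔ c j i = 0 := by
  refine ⟨fun hlt => ?_, h.blockIndex_lt hij⟩
  by_contra h0
  refine hlt.not_ge (Finset.card_le_card fun s hs => ?_)
  simp only [Finset.mem_filter, mem_starts] at hs ⊢
  refine ⟨hs.1, not_lt.1 fun hi => h0 ?_⟩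
  rcases hs.2.eq_or_lt with rfl | hsj
  · exact hs.1 i hi
  · exact h.lower_zero hi hsj (Or.inr (hs.1 i hi))

theorem ne_zero_of_blockIndex_eq (h : UltraMarkov c) {i j : ι} (hij : i < j)
    (he : blockIndex c i = blockIndex c j) : c j i ≠ 0 := fun h0 =>
  (h.blockIndex_lt hij h0).ne he

theorem blockIndex_pos (i : ι) : 1 ≤ blockIndex c i := by
  obtain ⟨s, hs, hmin⟩ := Set.toFinite {j | j ≤ i} |>.exists_minimal ⟨i, le_rfl⟩
  refine Finset.card_pos.2 ⟨s, Finset.mem_filter.2 ⟨mem_starts.2 fun k hk => ?_, hs⟩⟩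
  exact absurd (hmin (hk.le.trans hs) hk.le) (not_le.2 hk)

theorem range_blockIndex : Set.range (blockIndex c) = Set.Icc 1 (starts c).card := by
  classical
  ext t
  constructor
  · rintro ⟨i, rfl⟩
    exact ⟨blockIndex_pos i, Finset.card_filter_le _ _⟩
  · rintro ⟨h1, h2⟩
    obtain ⟨s, -, hs⟩ := exists_card_filter_le_eq (starts c) t h1 h2
    refine ⟨s, ?_⟩
    rw [← hs, blockIndex]

end Index

end UltraMarkov

/-! ### Entrywise descriptions, and the conditions on triples they imply -/

/-- The shape of a first diagonal block. -/
structure LeftBlock (c : ι → ι → ℝ) : Prop where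
  pos : ∀ i, 0 < c i i
  col : ∀ i j, i < j → c i j = c j j
  diag_le : ∀ i j, i < j → c j j ≤ c i i
  low_pos : ∀ i j, i < j → 0 < c j i
  low_le : ∀ i j, i < j → c j i ≤ c j j
  low_row : ∀ i j k, i < j → j < k → c k i = c k j
  low_eq : ∀ i j k, i < j → j < k → c j i = c j j
  strict : ∀ i j k, i < j → j < k → c j j < c i i

/-- The shape of the leading part, on the initial segment `P`, of a matrix in block form. -/
structure LeftPart (c : ι → ι → ℝ) (P : ι → Prop) : Prop where
  pos : ∀ i, P i → 0 < c i i
  col : ∀ i j, i < j → P j → c i j = c j j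
  diag_le : ∀ i j, i < j → P j → c j j ≤ c i i
  low_nonneg : ∀ i j, i < j → P j → 0 ≤ c j i
  low_le : ∀ i j, i < j → P j → c j i ≤ c j j
  triple : ∀ i j k, i < j → j < k → P k → (c j j = c k k ∧ c j i = 0 ∧ c k i = 0) ∨
    (c k i = c k j ∧ (c k j = 0 ∨ c j i = c j j))

/-- The entrywise description of a matrix in block form. -/
structure PointForm (c : ι → ι → ℝ) (P : ι → Prop) (w : ℝ) : Prop where
  lower : ∀ i j, i < j → P j → P i
  left : LeftPart c P
  right : LeftPart (flip c) (fun i => ¬ P (OrderDual.ofDual i))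
  corner : ∀ i j, P i → ¬ P j → c i j = w
  zero : ∀ i j, P i → ¬ P j → c j i = 0
  corner_pos : 0 < w
  corner_le : ∀ i, w ≤ c i i

theorem PointForm.flip {w : ℝ} (h : PointForm c P w) :
    PointForm (flip c) (fun i => ¬ P (OrderDual.ofDual i)) w where
  lower i j hij hj hi := hj (h.lower (OrderDual.ofDual j) (OrderDual.ofDual i) hij hi)
  left := h.right
  right :=
    { pos := fun _ hi => h.left.pos _ (not_not.1 hi)
      col := fun _ _ hij hj => h.left.col _ _ hij (not_not.1 hj)
      diag_le := fun _ _ hij hj => h.left.diag_le _ _ hij (not_not.1 hj)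
      low_nonneg := fun _ _ hij hj => h.left.low_nonneg _ _ hij (not_not.1 hj)
      low_le := fun _ _ hij hj => h.left.low_le _ _ hij (not_not.1 hj)
      triple := fun _ _ _ hij hjk hk => h.left.triple _ _ _ hij hjk (not_not.1 hk) }
  corner i j hi hj := h.corner _ _ (not_not.1 hj) hi
  zero i j hi hj := h.zero _ _ (not_not.1 hj) hi
  corner_pos := h.corner_pos
  corner_le i := h.corner_le _

namespace LeftPart

variable (h : LeftPart c P)
include h

/-- The distinguished index is i in the first alternative of `LeftPart.triple`, where i is cut off
from two equal diagonal entries, and k in the second. -/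
theorem isosceles {i j k : ι} (hij : i < j) (hjk : j < k) (hj : P j) (hk : P k) :
    Isosceles c i j k ∨ Isosceles c k i j := by
  have e1 := h.col i j hij hj
  have e2 := h.col i k (hij.trans hjk) hk
  have e3 := h.col j k hjk hk
  have p1 := h.pos j hj
  have p2 := h.pos k hk
  have n1 := h.low_nonneg i j hij hj
  have n2 := h.low_nonneg j k hjk hk
  have d := h.diag_le j k hjk hk
  rcases h.triple i j k hij hjk hk with ⟨h1, h2, h3⟩ | ⟨h1, h2⟩
  · refine Or.inl ⟨by rw [e1, e2, h1], by rw [h2, h3], ?_, ?_⟩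
    · rw [h2]; exact (min_le_left _ _).trans (le_min (e3 ▸ p2.le) n2)
    · rw [h2, e1, e3, max_eq_right p1.le, h1]; exact le_max_left _ _
  · refine Or.inr ⟨h1, by rw [e2, e3], ?_, ?_⟩
    · rw [e1, e2, h1]
      refine le_min ((min_le_left _ _).trans d) ?_
      rcases h2 with h2 | h2
      · rw [h2]; exact (min_le_right _ _).trans n1
      · rw [h2]; exact (min_le_left _ _).trans d
    · rw [e1, e2, h1]
      exact max_le (d.trans (le_max_left _ _)) ((h.low_le j k hjk hk).trans (d.trans (le_max_left _ _)))

theorem markov {i j k : ι} (hij : i < j) (hjk : j < k) (hj : P j) (hk : P k) :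
    c i k * c j j = c i j * c j k ∧ c k i * c j j = c k j * c j i := by
  rw [h.col i j hij hj, h.col i k (hij.trans hjk) hk, h.col j k hjk hk]
  refine ⟨mul_comm _ _, ?_⟩
  rcases h.triple i j k hij hjk hk with ⟨-, h2, h3⟩ | ⟨h1, h2 | h2⟩
  · rw [h2, h3]; ring
  · rw [h1, h2]; ring
  · rw [h1, h2]

end LeftPart

namespace PointForm

variable {w : ℝ}

theorem isosceles_of_mem (h : PointForm c P w) {i j k : ι} (hij : i < j) (hjk : j < k) (hj : P j) :
    Isosceles c i j k ∨ Isosceles c k i j := by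
  by_cases hk : P k
  · exact h.left.isosceles hij hjk hj hk
  · have hi := h.lower i j hij hj
    -- Beyond the cut, k has zero entries towards i and j and the common corner value from them, so
    -- k is the distinguished index.
    refine Or.inr ⟨?_, ?_, ?_, ?_⟩
    · rw [h.zero i k hi hk, h.zero j k hj hk]
    · rw [h.corner i k hi hk, h.corner j k hj hk]
    · rw [h.zero i k hi hk]
      exact (min_le_right _ _).trans
        (le_min (h.left.col i j hij hj ▸ (h.left.pos j hj).le) (h.left.low_nonneg i j hij hj))
    · rw [h.corner i k hi hk, h.zero i k hi hk, max_eq_left h.corner_pos.le, h.left.col i j hij hj]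
      exact (h.corner_le j).trans (le_max_left _ _)

theorem isosceles (h : PointForm c P w) {i j k : ι} (hij : i < j) (hjk : j < k) :
    Isosceles c i j k ∨ Isosceles c k i j := by
  by_cases hj : P j
  · exact h.isosceles_of_mem hij hjk hj
  · rcases h.flip.isosceles_of_mem (i := OrderDual.toDual k) (j := OrderDual.toDual j)
      (k := OrderDual.toDual i) hjk hij hj with h1 | h1
    · exact Or.inr h1.symm.transpose
    · exact Or.inl h1.symm.transpose

theorem markov_of_mem (h : PointForm c P w) {i j k : ι} (hij : i < j) (hjk : j < k) (hj : P j) :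
    c i k * c j j = c i j * c j k ∧ c k i * c j j = c k j * c j i := by
  by_cases hk : P k
  · exact h.left.markov hij hjk hj hk
  · have hi := h.lower i j hij hj
    rw [h.zero i k hi hk, h.zero j k hj hk, h.corner i k hi hk, h.corner j k hj hk,
      h.left.col i j hij hj]
    constructor <;> ring

theorem markov (h : PointForm c P w) : Markov c := by
  intro i j k hij hjk
  by_cases hj : P j
  · exact h.markov_of_mem hij hjk hj
  · obtain ⟨h1, h2⟩ := h.flip.markov_of_mem (i := OrderDual.toDual k) (j := OrderDual.toDual j)
      (k := OrderDual.toDual i) hjk hij hj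
    exact ⟨h1.trans (mul_comm _ _), h2.trans (mul_comm _ _)⟩

theorem bounds_of_mem (h : PointForm c P w) {i j : ι} (hij : i < j) (hi : P i) :
    (0 ≤ c i j ∧ c i j ≤ c i i ∧ c i j ≤ c j j) ∧ (0 ≤ c j i ∧ c j i ≤ c i i ∧ c j i ≤ c j j) := by
  by_cases hj : P j
  · have h1 := h.left.diag_le i j hij hj
    have h2 := h.left.low_le i j hij hj
    rw [h.left.col i j hij hj]
    exact ⟨⟨(h.left.pos j hj).le, h1, le_rfl⟩, h.left.low_nonneg i j hij hj, h2.trans h1, h2⟩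
  · rw [h.corner i j hi hj, h.zero i j hi hj]
    have h1 := h.corner_pos
    have h2 := h.corner_le i
    have h3 := h.corner_le j
    exact ⟨⟨h1.le, h2, h3⟩, le_rfl, h1.le.trans h2, h1.le.trans h3⟩

theorem bounds (h : PointForm c P w) {i j : ι} (hij : i < j) :
    (0 ≤ c i j ∧ c i j ≤ c i i ∧ c i j ≤ c j j) ∧ (0 ≤ c j i ∧ c j i ≤ c i i ∧ c j i ≤ c j j) := by
  by_cases hj : P j
  · exact h.bounds_of_mem hij (h.lower i j hij hj)
  · obtain ⟨⟨h1, h2, h3⟩, h4, h5, h6⟩ := h.flip.bounds_of_mem (i := OrderDual.toDual j)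
      (j := OrderDual.toDual i) hij hj
    exact ⟨⟨h1, h3, h2⟩, h4, h6, h5⟩

end PointForm

end Order

theorem PointForm.generalizedUltrametric {n : ℕ} {C : Matrix (Fin n) (Fin n) ℝ}
    {P : Fin n → Prop} {w : ℝ} (h : PointForm C P w) : GeneralizedUltrametric C where
  nonneg i j := by
    rcases lt_trichotomy i j with hij | rfl | hij
    · exact (h.bounds hij).1.1
    · exact h.corner_pos.le.trans (h.corner_le i)
    · exact (h.bounds hij).2.1
  diag i j := by
    rcases lt_trichotomy i j with hij | rfl | hij
    · exact max_le (h.bounds hij).1.2.1 (h.bounds hij).2.2.1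
    · simp
    · exact max_le (h.bounds hij).2.2.2 (h.bounds hij).1.2.2
  triangle S hS := by
    have e : S = {S.orderEmbOfFin hS 0, S.orderEmbOfFin hS 1, S.orderEmbOfFin hS 2} := by
      ext x
      have h1 : x ∈ S ↔ ∃ u, S.orderEmbOfFin hS u = x := by
        rw [← Set.mem_range, Finset.range_orderEmbOfFin, Finset.mem_coe]
      rw [h1]
      simp [Fin.exists_fin_succ, eq_comm]
    set i := S.orderEmbOfFin hS 0
    set j := S.orderEmbOfFin hS 1
    set k := S.orderEmbOfFin hS 2
    have hij : i < j := (S.orderEmbOfFin hS).strictMono (by decide)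
    have hjk : j < k := (S.orderEmbOfFin hS).strictMono (by decide)
    rcases h.isosceles hij hjk with h1 | h1
    · exact ⟨i, j, k, e, h1⟩
    · refine ⟨k, i, j, ?_, h1⟩
      rw [e]; ext x; simp; tauto

end Cyclops

/-! ### G-cyclopes with constant last column or constant first row -/

namespace Cyclops

variable {n : ℕ} {B : Matrix (Fin n) (Fin n) ℝ}

/-- The eye omits only the last index, the parameters are the diagonal entries, and b₁, b₂ come from
the last column and last row. In size one the eye is everything, and b₁, b₂ need only be positive
and at most the diagonal entry. -/
theorem LeftBlock.isGCyclops (h : LeftBlock B) (hdet : B.det ≠ 0) (hn : 0 < n) :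
    IsGCyclops B := by
  refine ⟨hdet, ?_⟩
  rcases n with _ | _ | n
  · omega
  · have : Subsingleton (Fin (0 + 1)) := inferInstanceAs (Subsingleton (Fin 1))
    refine ⟨1, fun i => B i i, B 0 0, B 0 0, le_rfl, ?_, ?_, ?_⟩
    · constructor
      · rfl
      · intro i j _ _; congr 1 <;> exact Subsingleton.elim _ _
      · intro i j _ _; congr 1 <;> exact Subsingleton.elim _ _
      · intro i j _ _; congr 1 <;> exact Subsingleton.elim _ _
      · intro i j _ _; congr 1 <;> exact Subsingleton.elim _ _
      · intro i j hij; exact absurd (Subsingleton.elim i j) hij.ne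
      · intro i j _ hij; exact absurd (Subsingleton.elim i j) hij.ne
    · intro i _; rw [Subsingleton.elim i 0, max_self]
    · simpa using h.pos 0
  · set l : Fin (n + 2) := Fin.last (n + 1) with hl
    have hlv : (l : ℕ) = n + 1 := rfl
    have hlt : ∀ i : Fin (n + 2), (i : ℕ) < n + 1 → i < l := fun i hi => Fin.lt_def.2 (by omega)
    have heq : ∀ i : Fin (n + 2), n + 1 ≤ (i : ℕ) → i = l := fun i hi => Fin.ext (by omega)
    have h0l : (0 : Fin (n + 2)) < l := hlt _ (by simp)
    refine ⟨n + 1, fun i => B i i, B l l, B l 0, by omega, ?_, ?_, ?_⟩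
    · constructor
      · omega
      · intro i j hi hj
        rcases lt_trichotomy i j with hij | rfl | hij
        · rw [max_eq_right hij.le, h.col i j hij]
        · rw [max_self]
        · rw [max_eq_left hij.le, h.low_eq j i l hij (hlt i hi)]
      · intro i j hi hj
        rw [heq i hi, heq j hj, min_self]
      · intro i j hi hj
        rw [heq j hj, h.col i l (hlt i hi)]
      · intro i j hi hj
        rw [heq i hi]
        rcases (Fin.zero_le j).eq_or_lt with h0 | h0
        · rw [← h0]
        · exact (h.low_row 0 j l h0 (hlt j hj)).symm
      · intro i j hij hj
        exact h.strict i j l hij (hlt j hj)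
      · intro i j hi hij
        have := Fin.lt_def.1 hij
        have := j.isLt
        omega
    · intro i _
      rw [max_eq_left (h.low_le 0 l h0l)]
      rcases (Fin.le_last i).eq_or_lt with h1 | h1
      · rw [h1]
      · exact h.diag_le i l h1
    · exact lt_min (h.pos l) (h.low_pos 0 l h0l)

/-- In the mirror image the eye is the first index alone, with b₁ read off the first row and b₂ off
the first column. -/
theorem LeftBlock.isGCyclops_of_flip (h : LeftBlock (flip B)) (hdet : B.det ≠ 0) (hn : 0 < n) :
    IsGCyclops B := by
  refine ⟨hdet, ?_⟩
  have hpos : ∀ i, 0 < B i i := fun i => h.pos (OrderDual.toDual i)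
  have hrow : ∀ i j, i < j → B i j = B i i := fun i j hij =>
    h.col (OrderDual.toDual j) (OrderDual.toDual i) hij
  have hle : ∀ i j, i < j → B i i ≤ B j j := fun i j hij =>
    h.diag_le (OrderDual.toDual j) (OrderDual.toDual i) hij
  have hlp : ∀ i j, i < j → 0 < B j i := fun i j hij =>
    h.low_pos (OrderDual.toDual j) (OrderDual.toDual i) hij
  have hll : ∀ i j, i < j → B j i ≤ B i i := fun i j hij =>
    h.low_le (OrderDual.toDual j) (OrderDual.toDual i) hij
  have hlr : ∀ i j k, i < j → j < k → B k i = B j i := fun i j k hij hjk =>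
    h.low_row (OrderDual.toDual k) (OrderDual.toDual j) (OrderDual.toDual i) hjk hij
  have hle' : ∀ i j k, i < j → j < k → B k j = B j j := fun i j k hij hjk =>
    h.low_eq (OrderDual.toDual k) (OrderDual.toDual j) (OrderDual.toDual i) hjk hij
  have hst : ∀ i j k, i < j → j < k → B j j < B k k := fun i j k hij hjk =>
    h.strict (OrderDual.toDual k) (OrderDual.toDual j) (OrderDual.toDual i) hjk hij
  rcases n with _ | n
  · omega
  set l : Fin (n + 1) := Fin.last n with hl
  have h0 : ∀ i : Fin (n + 1), (i : ℕ) < 1 → i = 0 := fun i hi => Fin.ext (by rw [Fin.val_zero]; omega)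
  have h0' : ∀ i : Fin (n + 1), 1 ≤ (i : ℕ) → 0 < i := fun i hi =>
    Fin.lt_def.2 (by rw [Fin.val_zero]; omega)
  have hb2 : B l 0 ≤ B 0 0 ∧ 0 < B l 0 := by
    rcases (Fin.zero_le l).eq_or_lt with h1 | h1
    · rw [← h1]; exact ⟨le_rfl, hpos 0⟩
    · exact ⟨hll 0 l h1, hlp 0 l h1⟩
  refine ⟨1, fun i => B i i, B 0 0, B l 0, le_rfl, ?_, ?_, lt_min (hpos 0) hb2.2⟩
  · constructor
    · omega
    · intro i j hi hj
      rw [h0 i hi, h0 j hj, max_self]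
    · intro i j hi hj
      rcases lt_trichotomy i j with hij | rfl | hij
      · rw [min_eq_left hij.le, hrow i j hij]
      · rw [min_self]
      · rw [min_eq_right hij.le, hle' 0 j i (h0' j hj) hij]
    · intro i j hi hj
      rw [h0 i hi, hrow 0 j (h0' j hj)]
    · intro i j hi hj
      rw [h0 j hj]
      rcases (Fin.le_last i).eq_or_lt with h1 | h1
      · rw [h1]
      · exact (hlr 0 i l (h0' i hi) h1).symm
    · intro i j hij hj
      have := Fin.lt_def.1 hij
      omega
    · intro i j hi hij
      exact hst 0 i j (h0' i hi) hij
  · intro i _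
    rw [max_eq_left hb2.1]
    rcases (Fin.zero_le i).eq_or_lt with h1 | h1
    · rw [← h1]
    · exact hle 0 i h1

/-- Outside the eye the parameters increase strictly and appear in the last column, so a constant
last column leaves at most one index there: the eye has size n or n - 1. -/
theorem IsGCyclops.leftBlock (h : IsGCyclops B) {v : ℝ}
    (hv : ∀ i j : Fin n, (j : ℕ) + 1 = n → B i j = v) : LeftBlock B := by
  obtain ⟨-, m, a, b₁, b₂, hm, hc, hb, hb0⟩ := h
  have hmn := hc.eye_le
  rcases n with _ | n
  · omega
  set l : Fin (n + 1) := Fin.last n with hl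
  have hlv : (l : ℕ) = n := rfl
  have hv' : ∀ i j, B i l = B j l := fun i j => (hv i l rfl).trans (hv j l rfl).symm
  obtain ⟨hb1, hb2⟩ := lt_min_iff.1 hb0
  have hnm : n ≤ m := by
    by_contra hlt
    push Not at hlt
    let k : Fin (n + 1) := ⟨m, by omega⟩
    have hkl : k < l := Fin.lt_def.2 hlt
    have h1 := hc.lower_right k l le_rfl hlt.le
    have h2 := hc.lower_right l l hlt.le hlt.le
    rw [min_eq_left hkl.le] at h1
    rw [min_self, hv' l k, h1] at h2
    exact (hc.increasing k l le_rfl hkl).ne h2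
  have hlt : ∀ i : Fin (n + 1), i < l → (i : ℕ) < m := fun i hi => by
    have := Fin.lt_def.1 hi
    omega
  have hdiag : ∀ i, B i i = a i := by
    intro i
    rcases lt_or_ge (i : ℕ) m with hi | hi
    · rw [hc.upper_left i i hi hi, max_self]
    · rw [hc.lower_right i i hi hi, min_self]
  have hl : ∀ i < l, a l ≤ a i ∧ 0 < B l i ∧ B l i ≤ a l ∧ 0 < a l := by
    intro i hi
    rcases hnm.eq_or_lt with h1 | h1
    · have e1 : B i l = b₁ := hc.upper_right i l (hlt i hi) (by omega)
      have e2 : B l i = b₂ := hc.lower_left l i (by omega) (hlt i hi)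
      have e3 : a l = b₁ := by rw [← hdiag, hv' l i, e1]
      have e4 := hb l (Or.inr (by omega))
      let k : Fin (n + 1) := ⟨m - 1, by omega⟩
      have e5 := hb k (Or.inl (by simp [k]; omega))
      have e6 : a k ≤ a i := by
        have hik : i ≤ k := Fin.le_def.2 (by have := hlt i hi; simp [k]; omega)
        rcases hik.eq_or_lt with e6 | e6
        · rw [e6]
        · exact (hc.decreasing i k e6 (by simp [k]; omega)).le
      refine ⟨?_, by rw [e2]; exact hb2, ?_, by rw [e3]; exact hb1⟩
      · rw [e3]; exact (le_max_left _ _).trans (e5.trans e6)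
      · rw [e2]; exact (le_max_right _ _).trans e4
    · have e1 : B l i = a l := by rw [hc.upper_left l i (by omega) (hlt i hi), max_eq_left hi.le]
      have e2 := hb l (Or.inl (by omega))
      have e3 : 0 < a l := hb1.trans_le ((le_max_left _ _).trans e2)
      exact ⟨(hc.decreasing i l hi (by omega)).le, by rw [e1]; exact e3, e1.le, e3⟩
  have hlow : ∀ i j, i < j → j < l → B j i = a j := by
    intro i j hij hj
    rw [hc.upper_left j i (hlt j hj) (hlt i (hij.trans hj)), max_eq_left hij.le]
  have hpos : ∀ i, 0 < a i := by
    intro i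
    rcases (Fin.le_last i).eq_or_lt with h1 | h1
    · rcases hnm.eq_or_lt with h2 | h2
      · have := hb i (Or.inr (by rw [h1]; simp; omega))
        exact hb1.trans_le ((le_max_left _ _).trans this)
      · have := hb i (Or.inl (by rw [h1]; simp; omega))
        exact hb1.trans_le ((le_max_left _ _).trans this)
    · exact (hl i h1).2.2.2.trans_le (hl i h1).1
  have hdec : ∀ i j, i < j → j < l → a j < a i := fun i j hij hj =>
    hc.decreasing i j hij (hlt j hj)
  constructor
  · intro i; rw [hdiag]; exact hpos i
  · intro i j hij
    rcases (Fin.le_last j).eq_or_lt with h1 | h1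
    · rw [h1]; exact hv' _ _
    · rw [hdiag, hc.upper_left i j (hlt i (hij.trans h1)) (hlt j h1), max_eq_right hij.le]
  · intro i j hij
    rw [hdiag, hdiag]
    rcases (Fin.le_last j).eq_or_lt with h1 | h1
    · rw [h1]; exact (hl i (hij.trans_eq h1)).1
    · exact (hdec i j hij h1).le
  · intro i j hij
    rcases (Fin.le_last j).eq_or_lt with h1 | h1
    · rw [h1]; exact (hl i (hij.trans_eq h1)).2.1
    · rw [hlow i j hij h1]; exact hpos j
  · intro i j hij
    rw [hdiag]
    rcases (Fin.le_last j).eq_or_lt with h1 | h1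
    · rw [h1]; exact (hl i (hij.trans_eq h1)).2.2.1
    · rw [hlow i j hij h1]
  · intro i j k hij hjk
    rcases (Fin.le_last k).eq_or_lt with h1 | h1
    · have hj : j < l := hjk.trans_eq h1
      rcases hnm.eq_or_lt with h2 | h2
      · rw [hc.lower_left k i (by rw [h1]; simp; omega) (hlt i (hij.trans hj)),
          hc.lower_left k j (by rw [h1]; simp; omega) (hlt j hj)]
      · rw [hc.upper_left k i (by rw [h1]; simp; omega) (hlt i (hij.trans hj)),
          hc.upper_left k j (by rw [h1]; simp; omega) (hlt j hj), max_eq_left hjk.le,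
          max_eq_left (hij.trans hjk).le]
    · rw [hlow i k (hij.trans hjk) h1, hlow j k hjk h1]
  · intro i j k hij hjk
    rw [hdiag, hlow i j hij (hjk.trans_le (Fin.le_last k))]
  · intro i j k hij hjk
    rw [hdiag, hdiag]
    exact hdec i j hij (hjk.trans_le (Fin.le_last k))

/-- Inside the eye the strictly decreasing parameters appear in the first row, so a constant first
row allows only an eye of size one. -/
theorem IsGCyclops.leftBlock_flip (h : IsGCyclops B) {v : ℝ}
    (hv : ∀ i j : Fin n, (i : ℕ) = 0 → B i j = v) : LeftBlock (flip B) := by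
  obtain ⟨-, m, a, b₁, b₂, hm, hc, hb, hb0⟩ := h
  have hmn := hc.eye_le
  rcases n with _ | n
  · omega
  have hv' : ∀ i j, B 0 i = B 0 j := fun i j => (hv 0 i rfl).trans (hv 0 j rfl).symm
  obtain ⟨hb1, hb2⟩ := lt_min_iff.1 hb0
  obtain rfl : m = 1 := by
    by_contra hne
    let k : Fin (n + 1) := ⟨1, by omega⟩
    have hk : (0 : Fin (n + 1)) < k := Fin.lt_def.2 (by simp [k])
    have h1 := hc.upper_left 0 k (by simp; omega) (by simp [k]; omega)
    have h2 := hc.upper_left 0 0 (by simp; omega) (by simp; omega)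
    rw [max_eq_right hk.le] at h1
    rw [max_self, hv' 0 k, h1] at h2
    exact (hc.decreasing 0 k hk (by simp [k]; omega)).ne h2
  have hge : ∀ i : Fin (n + 1), 0 < i → 1 ≤ (i : ℕ) := fun i hi => Fin.lt_def.1 hi
  have hdiag : ∀ i, B i i = a i := by
    intro i
    rcases lt_or_ge (i : ℕ) 1 with hi | hi
    · rw [hc.upper_left i i hi hi, max_self]
    · rw [hc.lower_right i i hi hi, min_self]
  have hcol : ∀ i, 0 < i → B i 0 = b₂ := fun i hi => hc.lower_left i 0 (hge i hi) (by simp)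
  have ha0 : b₂ ≤ a 0 := (le_max_right _ _).trans (hb 0 (Or.inl rfl))
  have ha0p : 0 < a 0 := hb2.trans_le ha0
  have hinc : ∀ i j, 0 < i → i < j → a i < a j := fun i j hi hij => hc.increasing i j (hge i hi) hij
  have ha : ∀ i, 0 < i → a 0 ≤ a i := by
    intro i hi
    have e1 : a 0 = b₁ := by
      rw [← hdiag, hv' 0 i]; exact hc.upper_right 0 i (by simp) (hge i hi)
    let k : Fin (n + 1) := ⟨1, by have := hge i hi; omega⟩
    have e2 := (le_max_left _ _).trans (hb k (Or.inr rfl))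
    rw [e1]
    rcases (show k ≤ i from hge i hi).eq_or_lt with h1 | h1
    · rw [← h1]; exact e2
    · exact e2.trans (hinc k i (Fin.lt_def.2 (by simp [k])) h1).le
  have hlow : ∀ i j, 0 < i → i < j → B j i = a i := fun i j hi hij => by
    rw [hc.lower_right j i (hge j (hi.trans hij)) (hge i hi), min_eq_right hij.le]
  have hrow : ∀ i j, i < j → B i j = B i i := by
    intro i j hij
    rcases (Fin.zero_le i).eq_or_lt with h1 | h1
    · rw [← h1]; exact hv' _ _
    · rw [hdiag, hc.lower_right i j (hge i h1) (hge j (h1.trans hij)), min_eq_left hij.le]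
  have hle : ∀ i j, i < j → B i i ≤ B j j := by
    intro i j hij
    rw [hdiag, hdiag]
    rcases (Fin.zero_le i).eq_or_lt with h1 | h1
    · rw [← h1]; exact ha j (h1 ▸ hij)
    · exact (hinc i j h1 hij).le
  have hpos : ∀ i, 0 < B i i := by
    intro i
    rw [hdiag]
    rcases (Fin.zero_le i).eq_or_lt with h1 | h1
    · rw [← h1]; exact ha0p
    · exact ha0p.trans_le (ha i h1)
  have hlp : ∀ i j, i < j → 0 < B j i := by
    intro i j hij
    rcases (Fin.zero_le i).eq_or_lt with h1 | h1
    · rw [← h1, hcol j (h1 ▸ hij)]; exact hb2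
    · rw [hlow i j h1 hij, ← hdiag]; exact hpos i
  have hll : ∀ i j, i < j → B j i ≤ B i i := by
    intro i j hij
    rw [hdiag]
    rcases (Fin.zero_le i).eq_or_lt with h1 | h1
    · rw [← h1, hcol j (h1 ▸ hij)]; exact ha0
    · rw [hlow i j h1 hij]
  have hlr : ∀ i j k, i < j → j < k → B k i = B j i := by
    intro i j k hij hjk
    rcases (Fin.zero_le i).eq_or_lt with h1 | h1
    · rw [← h1, hcol j (h1 ▸ hij), hcol k (h1 ▸ (hij.trans hjk))]
    · rw [hlow i j h1 hij, hlow i k h1 (hij.trans hjk)]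
  have hle' : ∀ i j k, i < j → j < k → B k j = B j j := fun i j k hij hjk => by
    rw [hdiag, hlow j k ((Fin.zero_le i).trans_lt hij) hjk]
  have hst : ∀ i j k, i < j → j < k → B j j < B k k := fun i j k hij hjk => by
    rw [hdiag, hdiag]
    exact hinc j k ((Fin.zero_le i).trans_lt hij) hjk
  exact
    { pos := fun i => hpos _
      col := fun i j hij => hrow _ _ hij
      diag_le := fun i j hij => hle _ _ hij
      low_pos := fun i j hij => hlp _ _ hij
      low_le := fun i j hij => hll _ _ hij
      low_row := fun i j k hij hjk => hlr _ _ _ hjk hij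
      low_eq := fun i j k hij hjk => hle' _ _ _ hjk hij
      strict := fun i j k hij hjk => hst _ _ _ hjk hij }

end Cyclops

/-! ### From the block form to its entrywise description -/

namespace Cyclops

section Order

variable {ι κ : Type*} [LinearOrder ι] [LinearOrder κ] {c : ι → ι → ℝ}

theorem LeftBlock.of_surjective {e : κ → ι} (he : StrictMono e) (hs : Function.Surjective e)
    (h : LeftBlock (fun a b => c (e a) (e b))) : LeftBlock c where
  pos := hs.forall.2 h.pos
  col := hs.forall₂.2 fun a b hab => h.col a b (he.lt_iff_lt.1 hab)
  diag_le := hs.forall₂.2 fun a b hab => h.diag_le a b (he.lt_iff_lt.1 hab)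
  low_pos := hs.forall₂.2 fun a b hab => h.low_pos a b (he.lt_iff_lt.1 hab)
  low_le := hs.forall₂.2 fun a b hab => h.low_le a b (he.lt_iff_lt.1 hab)
  low_row := hs.forall₃.2 fun a b k hab hbk =>
    h.low_row a b k (he.lt_iff_lt.1 hab) (he.lt_iff_lt.1 hbk)
  low_eq := hs.forall₃.2 fun a b k hab hbk =>
    h.low_eq a b k (he.lt_iff_lt.1 hab) (he.lt_iff_lt.1 hbk)
  strict := hs.forall₃.2 fun a b k hab hbk =>
    h.strict a b k (he.lt_iff_lt.1 hab) (he.lt_iff_lt.1 hbk)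

/-- The first `q` blocks of a matrix in block form; `g s` is the value of the columns above the
`s`-th diagonal block. -/
structure BlockHalf (c : ι → ι → ℝ) (β : ι → ℕ) (q : ℕ) (g : ℕ → ℝ) : Prop where
  mono : Monotone β
  one_le : ∀ i, 1 ≤ β i
  below : ∀ i j, β j < β i → c i j = 0
  first : LeftBlock (fun i j : {i // β i = 1} => c i j)
  first_le : ∀ i, β i = 1 → g 1 ≤ c i i
  col : ∀ i j, β i < β j → β j ≤ q → c i j = g (β j)
  diag : ∀ i, 2 ≤ β i → β i ≤ q → c i i = g (β i)
  pair : ∀ i j, i < j → β i = β j → 2 ≤ β j → β j ≤ q →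
    c i j = g (β j) ∧ 0 < c j i ∧ c j i < g (β j)
  three : ∀ i j k, i < j → j < k → β i = β k → 2 ≤ β k → β k ≤ q → False
  anti : ∀ s t, 1 ≤ s → s ≤ t → t ≤ q → g t ≤ g s
  pos : 0 < g q

/-- A pair lies in the first block, in one later block, or in two different blocks. For a triple the
position of j, k decides: if they share a later block, `three` pushes i into an earlier one. -/
theorem BlockHalf.leftPart {β : ι → ℕ} {q : ℕ} {g : ℕ → ℝ} (h : BlockHalf c β q g) :
    LeftPart c (fun i => β i ≤ q) := by
  have hcase : ∀ i j, i < j → (β i = 1 ∧ β j = 1) ∨ (2 ≤ β j ∧ β i = β j) ∨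
      (2 ≤ β j ∧ β i < β j) := by
    intro i j hij
    have h1 := h.one_le i
    have h2 := h.mono hij.le
    omega
  have hge : ∀ i, β i ≤ q → g (β i) ≤ c i i := by
    intro i hi
    rcases (h.one_le i).eq_or_lt with h1 | h1
    · rw [← h1]; exact h.first_le i h1.symm
    · exact (h.diag i h1 hi).ge
  have hpos : ∀ s, 1 ≤ s → s ≤ q → 0 < g s := fun s h1 h2 =>
    h.pos.trans_le (h.anti s q h1 h2 le_rfl)
  constructor
  · intro i hi
    exact (hpos _ (h.one_le i) hi).trans_le (hge i hi)
  · intro i j hij hj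
    rcases hcase i j hij with ⟨h1, h2⟩ | ⟨h1, h2⟩ | ⟨h1, h2⟩
    · exact h.first.col ⟨i, h1⟩ ⟨j, h2⟩ hij
    · rw [(h.pair i j hij h2 h1 hj).1, h.diag j h1 hj]
    · rw [h.col i j h2 hj, h.diag j h1 hj]
  · intro i j hij hj
    have hi : β i ≤ q := (h.mono hij.le).trans hj
    rcases hcase i j hij with ⟨h1, h2⟩ | ⟨h1, h2⟩ | ⟨h1, h2⟩
    · exact h.first.diag_le ⟨i, h1⟩ ⟨j, h2⟩ hij
    · rw [h.diag j h1 hj, ← h2]; exact hge i hi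
    · rw [h.diag j h1 hj]
      exact (h.anti _ _ (h.one_le i) h2.le hj).trans (hge i hi)
  · intro i j hij hj
    rcases hcase i j hij with ⟨h1, h2⟩ | ⟨h1, h2⟩ | ⟨h1, h2⟩
    · exact (h.first.low_pos ⟨i, h1⟩ ⟨j, h2⟩ hij).le
    · exact (h.pair i j hij h2 h1 hj).2.1.le
    · exact (h.below j i h2).ge
  · intro i j hij hj
    rcases hcase i j hij with ⟨h1, h2⟩ | ⟨h1, h2⟩ | ⟨h1, h2⟩
    · exact h.first.low_le ⟨i, h1⟩ ⟨j, h2⟩ hij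
    · rw [h.diag j h1 hj]; exact (h.pair i j hij h2 h1 hj).2.2.le
    · rw [h.below j i h2, h.diag j h1 hj]
      exact (hpos _ (h.one_le j) hj).le
  · intro i j k hij hjk hk
    have h0 := h.mono hij.le
    rcases hcase j k hjk with ⟨h1, h2⟩ | ⟨h1, h2⟩ | ⟨h1, h2⟩
    · have h3 : β i = 1 := le_antisymm (h0.trans h1.le) (h.one_le i)
      exact Or.inr ⟨h.first.low_row ⟨i, h3⟩ ⟨j, h1⟩ ⟨k, h2⟩ hij hjk,
        Or.inr (h.first.low_eq ⟨i, h3⟩ ⟨j, h1⟩ ⟨k, h2⟩ hij hjk)⟩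
    · have h3 : β i < β j := lt_of_le_of_ne h0 fun h3 =>
        h.three i j k hij hjk (h3.trans h2) h1 hk
      refine Or.inl ⟨?_, h.below j i h3, h.below k i (h2 ▸ h3)⟩
      rw [h.diag k h1 hk, h.diag j (h2 ▸ h1) (h2 ▸ hk), h2]
    · exact Or.inr ⟨by rw [h.below k j h2, h.below k i (h0.trans_lt h2)], Or.inl (h.below k j h2)⟩

end Order

variable {n : ℕ} {C : Matrix (Fin n) (Fin n) ℝ}

theorem mem_blockSet {β : Fin n → ℕ} {s : ℕ} {i : Fin n} : i ∈ blockSet β s ↔ β i = s := by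
  simp [blockSet]

/-- The increasing enumeration of a block. -/
def blockEmb (β : Fin n → ℕ) (s : ℕ) (u : Fin (blockSet β s).card) : {i // β i = s} :=
  ⟨(blockSet β s).orderEmbOfFin rfl u, mem_blockSet.1 (Finset.orderEmbOfFin_mem _ _ _)⟩

theorem blockEmb_strictMono (β : Fin n → ℕ) (s : ℕ) : StrictMono (blockEmb β s) := fun _ _ h =>
  ((blockSet β s).orderEmbOfFin rfl).strictMono h

theorem blockEmb_surjective (β : Fin n → ℕ) (s : ℕ) : Function.Surjective (blockEmb β s) := by
  rintro ⟨i, hi⟩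
  have h1 : i ∈ Set.range ((blockSet β s).orderEmbOfFin rfl) := by
    rw [Finset.range_orderEmbOfFin]; exact mem_blockSet.2 hi
  obtain ⟨u, hu⟩ := h1
  exact ⟨u, Subtype.ext hu⟩

namespace HasBlockForm

variable {m q : ℕ} {β : Fin n → ℕ} {f : ℕ → ℕ → ℝ}

theorem one_le (h : HasBlockForm C m q β f) (i : Fin n) : 1 ≤ β i :=
  (h.range_eq ▸ Set.mem_range_self i : β i ∈ Set.Icc 1 m).1

theorem le_m (h : HasBlockForm C m q β f) (i : Fin n) : β i ≤ m :=
  (h.range_eq ▸ Set.mem_range_self i : β i ∈ Set.Icc 1 m).2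

theorem middle_diag (h : HasBlockForm C m q β f) (i : Fin n) (h2 : 2 ≤ β i) (hm : β i ≤ m - 1) :
    C i i = f (β i) (β i) := by
  have hi : i ∈ blockSet β (β i) := mem_blockSet.2 rfl
  rcases h.middle (β i) h2 hm with ⟨k, hk, hk', -⟩ | ⟨k, l, g, -, hk, hk', -, -⟩
  · rw [hk, Finset.mem_singleton] at hi
    rw [← hk', ← hi]
  · rw [hk, Finset.mem_insert, Finset.mem_singleton] at hi
    rcases hi with hi | hi
    · have := congrFun (congrFun hk' 0) 0
      simp at this
      rwa [← hi] at this
    · have := congrFun (congrFun hk' 1) 1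
      simp at this
      rwa [← hi] at this

theorem middle_pair (h : HasBlockForm C m q β f) {i j : Fin n} (hij : i < j) (he : β i = β j)
    (h2 : 2 ≤ β j) (hm : β j ≤ m - 1) :
    blockSet β (β j) = {i, j} ∧ C i j = f (β j) (β j) ∧ 0 < C j i ∧ C j i < f (β j) (β j) := by
  have hi : i ∈ blockSet β (β j) := mem_blockSet.2 he
  have hj : j ∈ blockSet β (β j) := mem_blockSet.2 rfl
  rcases h.middle (β j) h2 hm with ⟨k, hk, -⟩ | ⟨k, l, g, hkl, hk, hk', h3, h4⟩
  · rw [hk, Finset.mem_singleton] at hi hj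
    exact absurd (hi.trans hj.symm) hij.ne
  · have e := hk
    rw [hk, Finset.mem_insert, Finset.mem_singleton] at hi hj
    obtain ⟨rfl, rfl⟩ : i = k ∧ j = l := by
      rcases hi with rfl | rfl <;> rcases hj with rfl | rfl
      · exact absurd rfl hij.ne
      · exact ⟨rfl, rfl⟩
      · exact absurd hij hkl.not_gt
      · exact absurd rfl hij.ne
    have e1 := congrFun (congrFun hk' 0) 1
    have e2 := congrFun (congrFun hk' 1) 0
    simp at e1 e2
    exact ⟨e, e1, by rw [e2]; exact h3, by rw [e2]; exact h4⟩

theorem middle_three (h : HasBlockForm C m q β f) {i j k : Fin n} (hij : i < j) (hjk : j < k)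
    (he : β i = β k) (h2 : 2 ≤ β k) (hm : β k ≤ m - 1) : False := by
  have h1 := (h.middle_pair (hij.trans hjk) he h2 hm).1
  have hj : j ∈ blockSet β (β k) := mem_blockSet.2
    (le_antisymm (h.mono hjk.le) (he ▸ h.mono hij.le))
  rw [h1, Finset.mem_insert, Finset.mem_singleton] at hj
  rcases hj with rfl | rfl
  · exact hij.false
  · exact hjk.false

theorem anti (h : HasBlockForm C m q β f) (s t : ℕ) (h1 : 1 ≤ s) (hst : s ≤ t) (ht : t ≤ q) :
    f t t ≤ f s s := by
  induction t, hst using Nat.le_induction with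
  | base => exact le_rfl
  | succ t hst ih => exact (h.diag_antitone t (h1.trans hst) (by omega)).trans (ih (by omega))

theorem monotone_diag (h : HasBlockForm C m q β f) (s t : ℕ) (h1 : q + 1 ≤ s) (hst : s ≤ t)
    (ht : t ≤ m) : f s s ≤ f t t := by
  induction t, hst using Nat.le_induction with
  | base => exact le_rfl
  | succ t hst ih => exact (ih (by omega)).trans (h.diag_monotone t (h1.trans hst) (by omega))

theorem exists_mem (h : HasBlockForm C m q β f) {s : ℕ} (h1 : 1 ≤ s) (h2 : s ≤ m) :
    0 < (blockSet β s).card := by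
  obtain ⟨i, hi⟩ := h.range_eq.ge ⟨h1, h2⟩
  exact Finset.card_pos.2 ⟨i, mem_blockSet.2 hi⟩

theorem blockHalf (h : HasBlockForm C m q β f) : BlockHalf C β q (fun s => f s s) where
  mono := h.mono
  one_le := h.one_le
  below := h.below
  first := (h.first_gcyclops.leftBlock h.first_column).of_surjective
    (c := fun i j : {i // β i = 1} => C i j) (blockEmb_strictMono β 1) (blockEmb_surjective β 1)
  first_le i hi := by
    have hL := h.first_gcyclops.leftBlock h.first_column
    have hc := h.exists_mem le_rfl (one_le_two.trans h.two_le)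
    obtain ⟨u, hu⟩ := blockEmb_surjective β 1 ⟨i, hi⟩
    let l : Fin (blockSet β 1).card := ⟨(blockSet β 1).card - 1, by omega⟩
    have hl : (l : ℕ) + 1 = (blockSet β 1).card := by simp [l]; omega
    have hul : u ≤ l := Fin.le_def.2 (by have := u.isLt; simp [l]; omega)
    have e : principalSubmatrix C (blockSet β 1) u u = C i i := by
      have : (blockSet β 1).orderEmbOfFin rfl u = i := congrArg Subtype.val hu
      simp [principalSubmatrix, this]
    rw [← e, ← h.first_column l l hl]
    rcases hul.eq_or_lt with h1 | h1
    · rw [h1]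
    · exact hL.diag_le u l h1
  col i j hij hj := by
    rw [h.flat i j hij]
    exact h.column_eq _ _ ((h.one_le i).trans_lt hij) hj (h.one_le i) hij.le
  diag i h2 hq := h.middle_diag i h2 (hq.trans h.q_le)
  pair i j hij he h2 hq := (h.middle_pair hij he h2 (hq.trans h.q_le)).2
  three i j k hij hjk he h2 hq := h.middle_three hij hjk he h2 (hq.trans h.q_le)
  anti := h.anti
  pos := h.diag_q_pos

/-- Reversal renumbers block s as `m + 1 - s`, so the last G-cyclops comes first and the `m - q`
blocks after the cut become the leading ones. -/
theorem blockHalf_flip (h : HasBlockForm C m q β f) :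
    BlockHalf (flip C) (fun i => m + 1 - β (OrderDual.ofDual i)) (m - q)
      (fun s => f (m + 1 - s) (m + 1 - s)) := by
  have hm := h.le_m
  have h1m := h.two_le
  have hqm := h.q_le
  have hq1 := h.one_le_q
  have hsub : ∀ i, m + 1 - (m + 1 - β i) = β i := fun i => by have := hm i; omega
  have h1s : m + 1 - 1 = m := by omega
  have hL := h.last_gcyclops.leftBlock_flip h.last_row
  have hone : ∀ i, m + 1 - β i = 1 ↔ β i = m := fun i => by have := hm i; omega
  constructor
  · intro i j hij
    have := h.mono (show OrderDual.ofDual j ≤ OrderDual.ofDual i from hij)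
    simp only; omega
  · intro i; have := hm (OrderDual.ofDual i); omega
  · intro i j hij
    exact h.below _ _ (by omega)
  · refine LeftBlock.of_surjective (κ := (Fin (blockSet β m).card)ᵒᵈ)
      (e := fun u => ⟨OrderDual.toDual (blockEmb β m (OrderDual.ofDual u)).1,
        (hone _).2 (blockEmb β m (OrderDual.ofDual u)).2⟩) ?_ ?_ hL
    · intro u v huv
      exact blockEmb_strictMono β m huv
    · rintro ⟨i, hi⟩
      obtain ⟨u, hu⟩ := blockEmb_surjective β m ⟨OrderDual.ofDual i, (hone _).1 hi⟩
      have hu' : (blockEmb β m u).1 = OrderDual.ofDual i := congrArg Subtype.val hu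
      exact ⟨OrderDual.toDual u, Subtype.ext hu'⟩
  · intro i hi
    have hc := h.exists_mem (one_le_two.trans h.two_le) le_rfl
    obtain ⟨u, hu⟩ := blockEmb_surjective β m ⟨OrderDual.ofDual i, (hone _).1 hi⟩
    let l : Fin (blockSet β m).card := ⟨0, hc⟩
    have hul : l ≤ u := Fin.le_def.2 (Nat.zero_le _)
    have e : principalSubmatrix C (blockSet β m) u u = flip C i i := by
      have : (blockSet β m).orderEmbOfFin rfl u = OrderDual.ofDual i := congrArg Subtype.val hu
      simp [principalSubmatrix, this, flip]
    rw [← e, h1s, ← h.last_row l l rfl]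
    rcases hul.eq_or_lt with h1 | h1
    · rw [h1]
    · exact hL.diag_le (OrderDual.toDual u) (OrderDual.toDual l) h1
  · intro i j hij hj
    have h1 := hm (OrderDual.ofDual i)
    have h2 := h.one_le (OrderDual.ofDual j)
    have hf := h.flat (OrderDual.ofDual j) (OrderDual.ofDual i) (by omega)
    rw [hsub]
    exact hf.trans (h.row_eq _ _ (by omega) (by omega) (by omega) h1)
  · intro i h2 hq
    rw [hsub]
    exact h.middle_diag _ (by omega) (by omega)
  · intro i j hij he h2 hq
    have h1 := hm (OrderDual.ofDual i)
    have h3 := hm (OrderDual.ofDual j)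
    have he' : β (OrderDual.ofDual j) = β (OrderDual.ofDual i) := by omega
    have := (h.middle_pair (i := OrderDual.ofDual j) (j := OrderDual.ofDual i) hij he'
      (by omega) (by omega)).2
    rw [hsub, he']
    exact this
  · intro i j k hij hjk he h2 hq
    have h1 := hm (OrderDual.ofDual i)
    have h3 := hm (OrderDual.ofDual k)
    exact h.middle_three (i := OrderDual.ofDual k) (j := OrderDual.ofDual j)
      (k := OrderDual.ofDual i) hjk hij (by omega) (by omega) (by omega)
  · intro s t h1 hst ht
    exact h.monotone_diag _ _ (by omega) (by omega) (by omega)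
  · have e : m + 1 - (m - q) = q + 1 := by omega
    rw [e]; exact h.diag_succ_q_pos

theorem pointForm (h : HasBlockForm C m q β f) :
    PointForm C (fun i => β i ≤ q) (f q (q + 1)) := by
  have hqm := h.q_le
  have hq1 := h.one_le_q
  have h2m := h.two_le
  have hright : LeftPart (flip C) (fun i => ¬ β (OrderDual.ofDual i) ≤ q) := by
    have e : (fun i : (Fin n)ᵒᵈ => ¬ β (OrderDual.ofDual i) ≤ q) =
        fun i => m + 1 - β (OrderDual.ofDual i) ≤ m - q := by
      funext i
      have := h.le_m (OrderDual.ofDual i)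
      exact propext (by omega)
    rw [e]
    exact h.blockHalf_flip.leftPart
  obtain ⟨hw1, hw2⟩ := le_min_iff.1 h.corner_le
  constructor
  · intro i j hij hj; exact (h.mono hij.le).trans hj
  · exact h.blockHalf.leftPart
  · exact hright
  · intro i j hi hj
    rw [h.flat i j (by omega)]
    exact h.corner_eq _ _ (h.one_le i) hi (by omega) (h.le_m j)
  · intro i j hi hj
    exact h.below j i (by omega)
  · exact h.corner_pos q (q + 1) hq1 le_rfl (by omega) (by omega)
  · intro i
    by_cases hi : β i ≤ q
    · refine hw1.trans ((h.anti _ _ (h.one_le i) hi le_rfl).trans ?_)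
      rcases (h.one_le i).eq_or_lt with h1 | h1
      · rw [← h1]; exact h.blockHalf.first_le i h1.symm
      · exact (h.middle_diag i h1 (by omega)).ge
    · refine hw2.trans ((h.monotone_diag _ _ le_rfl (by omega) (h.le_m i)).trans ?_)
      rcases (h.le_m i).eq_or_lt with h1 | h1
      · have h2 := h.blockHalf_flip.first_le (OrderDual.toDual i) (by simp [h1])
        have e : m + 1 - 1 = m := by omega
        simp only [e] at h2
        rw [h1]; exact h2
      · exact (h.middle_diag i (by omega) (by omega)).ge

end HasBlockForm

end Cyclops

/-! ### Construction of the block form -/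

namespace Cyclops

section Order

variable {ι κ : Type*} [LinearOrder ι] [LinearOrder κ] {c : ι → ι → ℝ} {P : ι → Prop}

namespace UltraMarkov

theorem IsCut.leftBlock (hP : IsCut c P) (h : UltraMarkov c) (hup : ∀ i j, i < j → 0 < c i j)
    {e : κ → ι} (he : StrictMono e) (heP : ∀ a, P (e a))
    (h0 : ∀ a b, a < b → c (e b) (e a) ≠ 0) : LeftBlock (fun a b => c (e a) (e b)) where
  pos a := h.pos _
  col a b hab := hP.col _ (heP b) _ (he hab)
  diag_le a b hab := hP.diag_le h (he hab).le (heP b)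
  low_pos a b hab := lt_of_le_of_ne (h.nonneg _ _) (h0 a b hab).symm
  low_le a b hab := h.le_row _ _
  low_row a b k hab hbk :=
    (hP.block_triple h hup (he hab) (he hbk) (heP k) (h0 a b hab) (h0 b k hbk)).1
  low_eq a b k hab hbk :=
    (hP.block_triple h hup (he hab) (he hbk) (heP k) (h0 a b hab) (h0 b k hbk)).2.1
  strict a b k hab hbk :=
    (hP.block_triple h hup (he hab) (he hbk) (heP k) (h0 a b hab) (h0 b k hbk)).2.2

end UltraMarkov

end Order

variable {n : ℕ} {C : Matrix (Fin n) (Fin n) ℝ}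

/-- The matrix is block triangular with respect to R and its complement, so this determinant is a
factor of `C.det`. -/
theorem det_principalSubmatrix_ne_zero (hdet : C.det ≠ 0) {R : Finset (Fin n)}
    (hR : ∀ i, i ∉ R → ∀ j ∈ R, C i j = 0) : (principalSubmatrix C R).det ≠ 0 := by
  have e : principalSubmatrix C R = (C.toSquareBlockProp (· ∈ R)).submatrix
      (R.orderIsoOfFin rfl).toEquiv (R.orderIsoOfFin rfl).toEquiv := rfl
  rw [e, Matrix.det_submatrix_equiv_self]
  intro h0
  rw [Matrix.twoBlockTriangular_det C (· ∈ R) hR] at hdet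
  refine hdet (mul_eq_zero_of_left ?_ _)
  convert h0

theorem det_principalSubmatrix_ne_zero' (hdet : C.det ≠ 0) {R : Finset (Fin n)}
    (hR : ∀ i ∈ R, ∀ j, j ∉ R → C i j = 0) : (principalSubmatrix C R).det ≠ 0 := by
  have h1 := det_principalSubmatrix_ne_zero (C := C.transpose) (by rwa [Matrix.det_transpose])
    (fun i hi j hj => hR j hj i hi)
  rwa [← Matrix.det_transpose] at h1

theorem GeneralizedUltrametric.ultraMarkov (h : GeneralizedUltrametric C) (hdet : C.det ≠ 0)
    (hM : Markov C) : UltraMarkov C where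
  pos := h.diag_pos hdet
  nonneg := h.nonneg
  le_row := h.le_row
  le_col := h.le_col
  isosceles i j k hij hjk := h.isosceles hij.ne (hij.trans hjk).ne hjk.ne
  markov := hM
  not_flat i j hij := h.not_flat hdet hij.ne

-- The blocks are those of `blockIndex`, q is the number of the last block inside P, and f samples C
-- at one representative per block.
open UltraMarkov in
theorem UltraMarkov.hasBlockForm (h : UltraMarkov C) (hdet : C.det ≠ 0)
    (hup : ∀ i j, i < j → 0 < C i j) {P : Fin n → Prop} (hP : IsCut C P) :
    ∃ (m q : ℕ) (β : Fin n → ℕ) (f : ℕ → ℕ → ℝ), HasBlockForm C m q β f := by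
  classical
  set β : Fin n → ℕ := blockIndex C with hβ
  have hmono : Monotone β := blockIndex_mono
  have hrange : Set.range β = Set.Icc 1 (starts C).card := range_blockIndex
  set m := (starts C).card with hm
  have hβm : ∀ i, 1 ≤ β i ∧ β i ≤ m := fun i => by
    have : β i ∈ Set.Icc 1 m := hrange ▸ Set.mem_range_self i
    exact this
  have hlt : ∀ i j, β i < β j → i < j := fun i j hij => by
    by_contra h1
    exact hij.not_ge (hmono (not_lt.1 h1))
  have hbelow : ∀ i j, β j < β i → C i j = 0 := fun i j hij =>
    (h.blockIndex_lt_iff (hlt j i hij)).1 hij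
  have hsame : ∀ i j, i < j → β i = β j → C j i ≠ 0 := fun i j hij he =>
    h.ne_zero_of_blockIndex_eq hij he
  obtain ⟨p, hp, hpmax⟩ := (Set.toFinite {i | P i}).exists_maximal hP.nonempty
  replace hpmax : ∀ i, P i → i ≤ p := fun i hi => (le_total i p).elim id (hpmax hi)
  set q := β p with hq
  have hPq : ∀ i, P i ↔ β i ≤ q := by
    intro i
    refine ⟨fun hi => hmono (hpmax i hi), fun hi => ?_⟩
    by_contra hi'
    exact (h.blockIndex_lt (hP.lt hp hi') (hP.zero p i hp hi')).not_ge hi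
  have hqm : q < m := by
    obtain ⟨k, hk⟩ := hP.nonempty_compl
    have := (hβm k).2
    rw [hPq] at hk
    omega
  have hq1 : 1 ≤ q := (hβm p).1
  have hex : ∀ s, 1 ≤ s → s ≤ m → ∃ i, β i = s := fun s h1 h2 => hrange.ge ⟨h1, h2⟩
  -- The representative is the last index of a block up to q and the first index of a later block,
  -- so that f₁₁ is the value of the last column of the first block and fₘₘ that of the first row of
  -- the last. Numbers outside 1, …, m get the dummy index p.
  have hrep : ∀ s, ∃ i, 1 ≤ s → s ≤ m → β i = s ∧ (s ≤ q → ∀ j, β j = s → j ≤ i) ∧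
      (q < s → ∀ j, β j = s → i ≤ j) := by
    intro s
    by_cases hs : 1 ≤ s ∧ s ≤ m
    · have hne : {i | β i = s}.Nonempty := hex s hs.1 hs.2
      rcases le_or_gt s q with hsq | hsq
      · obtain ⟨i, hi, hi'⟩ := (Set.toFinite {i | β i = s}).exists_maximal hne
        exact ⟨i, fun _ _ => ⟨hi, fun _ j hj => (le_total j i).elim id (hi' hj),
          fun h1 => absurd hsq h1.not_ge⟩⟩
      · obtain ⟨i, hi, hi'⟩ := (Set.toFinite {i | β i = s}).exists_minimal hne
        exact ⟨i, fun _ _ => ⟨hi, fun h1 => absurd hsq h1.not_gt,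
          fun _ j hj => (le_total i j).elim id (hi' hj)⟩⟩
    · exact ⟨p, fun h1 h2 => absurd ⟨h1, h2⟩ hs⟩
  choose e he using hrep
  have heβ : ∀ s, 1 ≤ s → s ≤ m → β (e s) = s := fun s h1 h2 => (he s h1 h2).1
  have helt : ∀ s t, 1 ≤ s → s < t → t ≤ m → e s < e t := fun s t h1 h2 h3 =>
    hlt _ _ (by rw [heβ s h1 (h2.le.trans h3), heβ t (h1.trans h2.le) h3]; exact h2)
  have hele : ∀ s t, 1 ≤ s → s ≤ t → t ≤ m → e s ≤ e t := fun s t h1 h2 h3 => by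
    rcases h2.eq_or_lt with rfl | h2
    · exact le_rfl
    · exact (helt s t h1 h2 h3).le
  have heP : ∀ s, 1 ≤ s → s ≤ q → P (e s) := fun s h1 h2 =>
    (hPq _).2 (by rw [heβ s h1 (by omega)]; exact h2)
  have heP' : ∀ s, q < s → s ≤ m → ¬ P (e s) := fun s h1 h2 => by
    rw [hPq, heβ s (by omega) h2]; omega
  obtain ⟨i₁, hi₁⟩ := hex 1 le_rfl (by omega)
  obtain ⟨iₘ, hiₘ⟩ := hex m (by omega) le_rfl
  -- the facts about a pair of indices in a middle block
  have hpair : ∀ i j, i < j → β i = β j → 2 ≤ β i → β i ≤ m - 1 →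
      C i i = C j j ∧ C j i < C i i ∧ C i j = C i i := by
    intro i j hij hb h2 h3
    by_cases hj : P j
    · exact hP.middle h hup (hlt i₁ i (by omega)) hij hj (hbelow _ _ (by omega)) (hsame i j hij hb)
    · have hi : ¬ P i := by rw [hPq] at hj ⊢; omega
      obtain ⟨h4, h5, h6⟩ := hP.flip.middle h.flip (fun i j hij => hup _ _ hij)
        (a := OrderDual.toDual iₘ) (i := OrderDual.toDual j) (j := OrderDual.toDual i)
        (hlt j iₘ (by omega)) hij hi (hbelow iₘ j (by omega)) (hsame i j hij hb)
      replace h4 : C j j = C i i := h4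
      exact ⟨h4.symm, h4 ▸ h5, h4 ▸ h6⟩
  have hthree : ∀ i j k, i < j → j < k → β i = β j → β j = β k → 2 ≤ β i → β i ≤ m - 1 →
      False := by
    intro i j k hij hjk hb hb' h2 h3
    by_cases hk : P k
    · exact hP.middle_size h hup (hlt i₁ i (by omega)) hij hjk hk (hbelow _ _ (by omega))
        (hsame i j hij hb) (hsame j k hjk hb')
    · have hi : ¬ P i := by rw [hPq] at hk ⊢; omega
      exact hP.flip.middle_size h.flip (fun i j hij => hup _ _ hij)
        (a := OrderDual.toDual iₘ) (i := OrderDual.toDual k) (j := OrderDual.toDual j)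
        (k := OrderDual.toDual i) (hlt k iₘ (by omega)) hjk hij hi (hbelow iₘ k (by omega))
        (hsame j k hjk hb') (hsame i j hij hb)
  have hconst : ∀ i j, β i = β j → 2 ≤ β i → β i ≤ m - 1 → C i i = C j j := by
    intro i j hb h2 h3
    rcases lt_trichotomy i j with hij | rfl | hij
    · exact (hpair i j hij hb h2 h3).1
    · rfl
    · exact (hpair j i hij hb.symm (hb ▸ h2) (hb ▸ h3)).1.symm
  have hdet₁ : (principalSubmatrix C (blockSet β 1)).det ≠ 0 := by
    refine det_principalSubmatrix_ne_zero hdet fun i hi j hj => hbelow i j ?_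
    rw [mem_blockSet] at hi hj
    have := (hβm i).1
    omega
  have hdetₘ : (principalSubmatrix C (blockSet β m)).det ≠ 0 := by
    refine det_principalSubmatrix_ne_zero' hdet fun i hi j hj => hbelow i j ?_
    rw [mem_blockSet] at hi hj
    have := (hβm j).2
    omega
  have hcard : ∀ i, 0 < (blockSet β (β i)).card := fun i =>
    Finset.card_pos.2 ⟨i, mem_blockSet.2 rfl⟩
  have hemb : ∀ s u, β ((blockSet β s).orderEmbOfFin rfl u) = s := fun s u =>
    mem_blockSet.1 (Finset.orderEmbOfFin_mem _ _ _)
  have hsurj : ∀ s i, β i = s → ∃ u, (blockSet β s).orderEmbOfFin rfl u = i := fun s i hi => by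
    have h1 : i ∈ Set.range ((blockSet β s).orderEmbOfFin rfl) := by
      rw [Finset.range_orderEmbOfFin]; exact mem_blockSet.2 hi
    exact h1
  refine ⟨m, q, β, fun s t => C (e s) (e t), ?_⟩
  constructor
  · omega
  · exact hmono
  · exact hrange
  · exact hbelow
  · refine LeftBlock.isGCyclops ?_ hdet₁ (hi₁ ▸ hcard i₁)
    exact hP.leftBlock h hup (e := (blockSet β 1).orderEmbOfFin rfl) (OrderEmbedding.strictMono _)
      (fun u => (hPq _).2 (by rw [hemb]; exact hq1))
      (fun u v huv => hsame _ _ (OrderEmbedding.strictMono _ huv) (by rw [hemb, hemb]))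
  · intro u v hv
    have hle : ∀ a, (blockSet β 1).orderEmbOfFin rfl a ≤ e 1 := fun a =>
      (he 1 le_rfl (by omega)).2.1 hq1 _ (hemb 1 a)
    have hev : (blockSet β 1).orderEmbOfFin rfl v = e 1 := by
      obtain ⟨w, hw⟩ := hsurj 1 (e 1) (heβ 1 le_rfl (by omega))
      refine le_antisymm (hle v) ?_
      rw [← hw]
      exact ((blockSet β 1).orderEmbOfFin rfl).monotone (Fin.le_def.2 (by omega))
    rw [principalSubmatrix, Matrix.submatrix_apply, hev]
    rcases (hle u).eq_or_lt with h1 | h1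
    · rw [h1]
    · exact hP.col _ (heP 1 le_rfl hq1) _ h1
  · refine LeftBlock.isGCyclops_of_flip ?_ hdetₘ (hiₘ ▸ hcard iₘ)
    exact hP.flip.leftBlock h.flip (fun i j hij => hup _ _ hij)
      (e := fun u : (Fin (blockSet β m).card)ᵒᵈ =>
        OrderDual.toDual ((blockSet β m).orderEmbOfFin rfl (OrderDual.ofDual u)))
      (fun u v huv => OrderEmbedding.strictMono ((blockSet β m).orderEmbOfFin rfl) huv)
      (fun u hu => by
        have := (hPq _).1 hu
        simp only [OrderDual.ofDual_toDual] at this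
        rw [hemb] at this
        omega)
      (fun u v huv => hsame _ _
        (OrderEmbedding.strictMono ((blockSet β m).orderEmbOfFin rfl) huv) (by
          simp only [OrderDual.ofDual_toDual]; rw [hemb, hemb]))
  · intro u v hu
    have hle : ∀ a, e m ≤ (blockSet β m).orderEmbOfFin rfl a := fun a =>
      (he m (by omega) le_rfl).2.2 hqm _ (hemb m a)
    have heu : (blockSet β m).orderEmbOfFin rfl u = e m := by
      obtain ⟨w, hw⟩ := hsurj m (e m) (heβ m (by omega) le_rfl)
      refine le_antisymm ?_ (hle u)
      rw [← hw]
      exact ((blockSet β m).orderEmbOfFin rfl).monotone (Fin.le_def.2 (by omega))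
    rw [principalSubmatrix, Matrix.submatrix_apply, heu]
    rcases (hle v).eq_or_lt with h1 | h1
    · rw [← h1]
    · exact hP.row _ (heP' m hqm le_rfl) _ h1
  · intro i j hij
    have hi := hβm i
    have hj := hβm j
    have hee := helt (β i) (β j) hi.1 hij hj.2
    rcases le_or_gt (β j) q with h1 | h1
    · rw [hP.col j ((hPq j).2 h1) i (hlt i j hij), hP.col _ (heP _ hj.1 h1) _ hee]
      -- The block of j is neither the first, as that of i precedes it, nor the last, as q < m; so
      -- its diagonal is constant.
      exact hconst _ _ (heβ _ hj.1 hj.2).symm (by omega) (by omega)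
    · rcases le_or_gt (β i) q with h2 | h2
      · exact hP.corner h ((hPq i).2 h2) (heP _ hi.1 h2) (by rw [hPq]; omega) (heP' _ h1 hj.2)
      · rw [hP.row i (by rw [hPq]; omega) j (hlt i j hij), hP.row _ (heP' _ h2 hi.2) _ hee]
        exact hconst _ _ (heβ _ hi.1 hi.2).symm (by omega) (by omega)
  · intro s hs2 hsm
    have hes := heβ s (by omega) (by omega)
    by_cases hone : ∀ j, β j = s → j = e s
    · refine Or.inl ⟨e s, ?_, rfl, h.pos _⟩
      ext j
      rw [mem_blockSet, Finset.mem_singleton]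
      exact ⟨hone j, fun hj => hj ▸ hes⟩
    · push Not at hone
      obtain ⟨j, hj, hjne⟩ := hone
      obtain ⟨a, b, hab, ha, hb⟩ : ∃ a b, a < b ∧ β a = s ∧ β b = s := by
        rcases hjne.lt_or_gt with h1 | h1
        · exact ⟨j, e s, h1, hj, hes⟩
        · exact ⟨e s, j, h1, hes, hj⟩
      have h1 := hpair a b hab (ha.trans hb.symm) (by omega) (by omega)
      have h2 := hconst a (e s) (ha.trans hes.symm) (by omega) (by omega)
      refine Or.inr ⟨a, b, C b a, hab, ?_, ?_, ?_, ?_⟩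
      · ext k
        rw [mem_blockSet, Finset.mem_insert, Finset.mem_singleton]
        constructor
        · intro hk
          by_contra! hne
          rcases hne.1.lt_or_gt with h3 | h3
          · exact hthree k a b h3 hab (by omega) (by omega) (by omega) (by omega)
          · rcases hne.2.lt_or_gt with h4 | h4
            · exact hthree a k b h3 h4 (by omega) (by omega) (by omega) (by omega)
            · exact hthree a b k hab h4 (by omega) (by omega) (by omega) (by omega)
        · rintro (rfl | rfl)
          · exact ha
          · exact hb
      · ext u v
        fin_cases u <;> fin_cases v
        · exact h2
        · exact h1.2.2.trans h2
        · rfl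
        · exact h1.1.symm.trans h2
      · exact lt_of_le_of_ne (h.nonneg _ _) (hsame a b hab (ha.trans hb.symm)).symm
      · rw [← h2]; exact h1.2.1
  · exact hq1
  · omega
  · intro s h1 h2
    exact hP.diag_le h (hele s (s + 1) h1 (by omega) (by omega)) (heP _ (by omega) (by omega))
  · exact h.pos _
  · exact h.pos _
  · intro s h1 h2
    exact hP.flip.diag_le h.flip (i := OrderDual.toDual (e (s + 1))) (j := OrderDual.toDual (e s))
      (hele s (s + 1) (by omega) (by omega) (by omega)) (heP' s (by omega) (by omega))
  · intro s t h1 h2 h3 h4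
    rcases h4.eq_or_lt with rfl | h4
    · rfl
    · exact hP.col _ (heP t (by omega) h2) _ (helt s t h3 h4 (by omega))
  · intro s t h1 h2 h3 h4
    rcases h3.eq_or_lt with rfl | h3
    · rfl
    · exact hP.row _ (heP' s h1 (by omega)) _ (helt s t (by omega) h3 h4)
  · intro s t h1 h2 h3 h4
    exact hup _ _ (helt s t h1 (by omega) h4)
  · intro s t h1 h2 h3 h4
    exact hP.corner h (heP s h1 h2) (heP q hq1 le_rfl) (heP' t h3 h4) (heP' (q + 1) (by omega) hqm)
  · exact le_min (h.le_row _ _) (h.le_col _ _)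

theorem completelyReducible_of_cut {s t : Fin n} (hts : t < s)
    (h : ∀ a b, a < s → s ≤ b → C a b = 0 ∧ C b a = 0) : CompletelyReducible C :=
  ⟨{i | i < s}, ⟨t, hts⟩, ⟨s, lt_irrefl s⟩, fun i hi j hj => h i j hi (not_lt.1 hj)⟩

theorem UltraMarkov.exists_hasBlockForm (h : UltraMarkov C) (hdet : C.det ≠ 0)
    (hred : ¬ Irreducible C) (hup : ∀ i j, i < j → 0 < C i j) :
    ∃ (m q : ℕ) (β : Fin n → ℕ) (f : ℕ → ℕ → ℝ), HasBlockForm C m q β f := by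
  -- With no zero below the diagonal all entries are nonzero, and single arcs already connect any
  -- two indices.
  obtain ⟨i, j, hij, h0⟩ : ∃ i j, i < j ∧ C j i = 0 := by
    by_contra! hcon
    refine hred fun i j => Relation.ReflTransGen.single ?_
    rcases lt_trichotomy i j with hij | rfl | hij
    · exact (hup i j hij).ne'
    · exact (h.pos i).ne'
    · exact hcon j i hij
  obtain ⟨P, hP⟩ := h.exists_isCut hup hij h0
  exact h.hasBlockForm hdet hup hP

theorem Irreducible.of_transpose (h : Irreducible C.transpose) : Irreducible C := fun i j =>
  Relation.reflTransGen_swap.1 (h j i)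

/-- By `exists_cut`, zeros on both sides of the diagonal would make C completely reducible; the side
free of zeros decides between C and its transpose. -/
theorem GeneralizedUltrametric.blockForm (h : GeneralizedUltrametric C) (hM : Markov C)
    (hdet : C.det ≠ 0) (hred : ¬ Irreducible C) (hncr : ¬ CompletelyReducible C) :
    (∃ (m q : ℕ) (β : Fin n → ℕ) (f : ℕ → ℕ → ℝ), HasBlockForm C m q β f) ∨
      (∃ (m q : ℕ) (β : Fin n → ℕ) (f : ℕ → ℕ → ℝ), HasBlockForm C.transpose m q β f) := by
  have hU := h.ultraMarkov hdet hM
  by_cases hup : ∀ i j, i < j → 0 < C i j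
  · exact Or.inl (hU.exists_hasBlockForm hdet hred hup)
  by_cases hlow : ∀ i j, i < j → 0 < C j i
  · exact Or.inr ((h.transpose.ultraMarkov (by rwa [Matrix.det_transpose])
      hM.transpose).exists_hasBlockForm (by rwa [Matrix.det_transpose])
      (fun h1 => hred h1.of_transpose) hlow)
  push Not at hup hlow
  obtain ⟨i, j, hij, h1⟩ := hup
  obtain ⟨k, l, hkl, h2⟩ := hlow
  obtain ⟨s, t, hts, h3⟩ := hU.exists_cut hij (le_antisymm h1 (h.nonneg _ _)) hkl
    (le_antisymm h2 (h.nonneg _ _))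
  exact absurd (completelyReducible_of_cut hts h3) hncr

theorem generalizedUltrametric_and_markov_of_blockForm
    (h : (∃ (m q : ℕ) (β : Fin n → ℕ) (f : ℕ → ℕ → ℝ), HasBlockForm C m q β f) ∨
      (∃ (m q : ℕ) (β : Fin n → ℕ) (f : ℕ → ℕ → ℝ), HasBlockForm C.transpose m q β f)) :
    GeneralizedUltrametric C ∧ Markov C := by
  rcases h with ⟨m, q, β, f, h⟩ | ⟨m, q, β, f, h⟩
  · exact ⟨h.pointForm.generalizedUltrametric, h.pointForm.markov⟩
  · have h1 := h.pointForm.generalizedUltrametric.transpose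
    have h2 := Markov.transpose h.pointForm.markov
    rw [Matrix.transpose_transpose] at h1 h2
    exact ⟨h1, h2⟩

end Cyclops

theorem mainTheorem11 {n : ℕ} (C : Matrix (Fin n) (Fin n) ℝ) (hdet : C.det ≠ 0)
    (hred : ¬ Cyclops.Irreducible C) (hncr : ¬ Cyclops.CompletelyReducible C) :
    List.TFAE [
      (∃ (m q : ℕ) (β : Fin n → ℕ) (f : ℕ → ℕ → ℝ), Cyclops.HasBlockForm C m q β f) ∨
        (∃ (m q : ℕ) (β : Fin n → ℕ) (f : ℕ → ℕ → ℝ),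
          Cyclops.HasBlockForm C.transpose m q β f),
      Cyclops.GeneralizedUltrametric C ∧ Cyclops.Tridiagonal C⁻¹,
      Cyclops.GeneralizedUltrametric C ∧ Cyclops.TotallyNonneg C] := by
  tfae_have 1 → 2 := fun h => by
    obtain ⟨h1, h2⟩ := Cyclops.generalizedUltrametric_and_markov_of_blockForm h
    exact ⟨h1, h2.tridiagonal_inv hdet fun i => (h1.diag_pos hdet i).ne'⟩
  tfae_have 2 → 3 := fun ⟨h1, h2⟩ =>
    ⟨h1, (h2.markov hdet fun i => (h1.diag_pos hdet i).ne').det_submatrix_nonneg h1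
      (h1.diag_pos hdet)⟩
  tfae_have 3 → 1 := fun ⟨h1, h2⟩ => h1.blockForm (h2.markov h1) hdet hred hncr
  tfae_finish
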